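/- \textbf{Lemma (Regret and communication cost of DisKernelUCB).} \emph{Setting.} Let $d,N,T\ge 1$, let $\phi:\mathbb R^d\to\mathcal H$ be a feature map into a real Hilbert space with (measurable) kernel $k(x,x')=\langle\phi(x),\phi(x')\rangle$, let $\theta_\star\in\mathcal H$, and let $\mathcal A\subseteq\mathbb R^d$ satisfy $\|\phi(x)\|\le L$ for all $x\in\mathcal A$ and $\|\phi(x)\|\ge\kappa$ for some $x\in\mathcal A$, where $L,\kappa>0$. Fix $\lambda,R>0$ and $\delta\in(0,1)$. At time steps $t=1,\dots,NT$, client $i_t\in\{1,\dots,N\}$, $i_t\equiv t \pmod N$, is given a (possibly random) candidate set $\mathcal A_t\subseteq\mathcal A$, plays an arm $x_t\in\mathcal A_t$, and observes $y_t=\langle\theta_\star,\phi(x_t)\rangle+\eta_t$. Given $\sigma\big((x_s,\eta_s)_{s<t},x_t\big)$, the noise $\eta_t$ is conditionally zero-mean and $R$-sub-Gaussian: $\mathbb E[e^{u\eta_t}\mid\cdot]\le e^{u^2R^2/2}$ for all $u\in\mathbb R$. For a finite sequence $S$ of arms or of indices of played arms, let $K_{S,S}$ be its kernel matrix and $\ell(S)=\log\det(I+\lambda^{-1}K_{S,S})$.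 Let $\gamma_{NT}=\sup\tfrac12\ell(S)$ over all sequences $S$ of $NT$ arms of $\mathcal A$, repetitions allowed. \emph{Algorithm.} Client $j$ has a data set $\mathcal D(j)$ and an upload buffer $\Delta\mathcal D(j)$, both initially empty sets of time indices; initially $t_{\rm last}=0$. At time $t$, with $i=i_t$ and $S=\mathcal D(i)$, client $i$ plays an arm $x_t$ that maximizes $\hat\mu_S(x)+\alpha_S\hat\sigma_S(x)$ over $\mathcal A_t$ (such a maximizer is assumed to exist), where, with $K_S(x)=[k(x_s,x)]_{s\in S}$, $$\hat\mu_S(x)=K_S(x)^\top(K_{S,S}+\lambda I)^{-1}y_S,\qquad \hat\sigma_S(x)=\lambda^{-1/2}\sqrt{k(x,x)-K_S(x)^\top(K_{S,S}+\lambda I)^{-1}K_S(x)},$$ $$\alpha_S=\sqrt\lambda\,\|\theta_\star\|+R\sqrt{4\ln(N/\delta)+2\,\ell(S)} .$$ Then $t$ is added to $\mathcal D(i)$ and to $\Delta\mathcal D(i)$. If now $$(|\mathcal D(i)|-t_{\rm last})\,\big(\ell(\mathcal D(i))-\ell(\mathcal D(i)\setminus\Delta\mathcal D(i))\big)>D:=\frac{T}{N\gamma_{NT}},$$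 a global synchronization takes place: every client $j$ uploads the raw data $(x_s,y_s)_{s\in\Delta\mathcal D(j)}$; the server sends to every client $j$ the raw data $(x_s,y_s)$, $s\in\{1,\dots,t\}\setminus\mathcal D(j)$, which that client is missing; then $\mathcal D(j)=\{1,\dots,t\}$ and $\Delta\mathcal D(j)=\emptyset$ for all $j$, and $t_{\rm last}=t$. Each data point costs $d+1$ scalars per transfer. Let $R_{NT}=\sum_{t=1}^{NT}\big(\sup_{x\in\mathcal A_t}\langle\theta_\star,\phi(x)\rangle-\langle\theta_\star,\phi(x_t)\rangle\big)$, let $B$ be the number of synchronizations and $C_{NT}$ the total number of scalars transferred, up to time $NT$. \emph{Claim.} There are an absolute constant $c>0$ and a constant $C>0$ depending only on $\lambda,R,L,\kappa,\delta$ such that in every such setting: \begin{enumerate} \item with probability at least $1-\delta$, $\;R_{NT}\le C\sqrt{NT}\,\big(\|\theta_\star\|\sqrt{\gamma_{NT}}+\gamma_{NT}\big)$; \item always, $B\le c\,\big(\sqrt N\,\gamma_{NT}+N\gamma_{NT}^2/T\big)$; and if $\sqrt N\,\gamma_{NT}\le T$, then $B\le c\,\sqrt N\,\gamma_{NT}$;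 \item always (in the worst case), $C_{NT}\le c\,T N^2 d$. \end{enumerate} -/

import Mathlib

open MeasureTheory

namespace DisKernelUCB

noncomputable section

/-! Interactions are numbered from `0`: interaction `s` is time step `s + 1`, and it is carried out by
client `s % N` (clients are numbered `0, …, N - 1`).  A data set is the finite set of the numbers of the
interactions whose data points it contains. -/

section Kernel

variable {E H : Type*} [NormedAddCommGroup H] [InnerProductSpace ℝ H]

/-- The kernel `k(x, x') = ⟨φ(x), φ(x')⟩` of the feature map `φ`. -/
def kernel (φ : E → H) (x x' : E) : ℝ := inner ℝ (φ x) (φ x')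

/-- The kernel matrix `K = [k(z i, z j)]` of a finite family of arms. -/
def kernelMatrix {ι : Type*} (φ : E → H) (z : ι → E) : Matrix ι ι ℝ :=
  Matrix.of fun i j => kernel φ (z i) (z j)

/-- `det (I + K / lam)` for a finite family of arms. -/
def infoDet {ι : Type*} [Fintype ι] [DecidableEq ι] (φ : E → H) (lam : ℝ) (z : ι → E) : ℝ :=
  (1 + lam⁻¹ • kernelMatrix φ z).det

/-- Maximum information gain `γ_n`: the supremum of `(1/2) log det (I + K / lam)` over all choices of `n`
arms of `A` (repetitions allowed). -/
def maxInfoGain (φ : E → H) (lam : ℝ) (A : Set E) (n : ℕ) : ℝ :=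
  ⨆ z : Fin n → A, (1 / 2) * Real.log (infoDet φ lam fun i => (z i : E))

/-- `det (I + K_{S,S} / lam)` for the data set `S` of a sequence of arms `x`. -/
def dataDet (φ : E → H) (lam : ℝ) (x : ℕ → E) (S : Finset ℕ) : ℝ :=
  infoDet φ lam fun s : S => x s

/-- The vector `K_S(z) = [k(x s, z)]_{s ∈ S}`. -/
def kernelVec (φ : E → H) (x : ℕ → E) (S : Finset ℕ) (z : E) : S → ℝ :=
  fun s => kernel φ (x s) z

/-- The matrix `(K_{S,S} + lam I)⁻¹`. -/
def ridgeInv (φ : E → H) (lam : ℝ) (x : ℕ → E) (S : Finset ℕ) : Matrix S S ℝ :=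
  (kernelMatrix φ (fun s : S => x s) + lam • (1 : Matrix S S ℝ))⁻¹

/-- Estimated mean reward `K_S(z)ᵀ (K_{S,S} + lam I)⁻¹ y_S` of arm `z`. -/
def muHat (φ : E → H) (lam : ℝ) (x : ℕ → E) (y : ℕ → ℝ) (S : Finset ℕ) (z : E) : ℝ :=
  kernelVec φ x S z ⬝ᵥ (ridgeInv φ lam x S).mulVec fun s : S => y s

/-- Estimated deviation `lam^(-1/2) √(k(z,z) - K_S(z)ᵀ (K_{S,S} + lam I)⁻¹ K_S(z))` of arm `z`. -/
def sigmaHat (φ : E → H) (lam : ℝ) (x : ℕ → E) (S : Finset ℕ) (z : E) : ℝ :=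
  (Real.sqrt lam)⁻¹ * Real.sqrt (kernel φ z z
    - kernelVec φ x S z ⬝ᵥ (ridgeInv φ lam x S).mulVec (kernelVec φ x S z))

/-- Exploration coefficient
`√lam ‖θ‖ + R √(4 log (N/δ) + 2 log det (I + K_{S,S} / lam))`. -/
def alpha (φ : E → H) (θ : H) (lam R δ : ℝ) (N : ℕ) (x : ℕ → E) (S : Finset ℕ) : ℝ :=
  Real.sqrt lam * ‖θ‖
    + R * Real.sqrt (4 * Real.log (N / δ) + 2 * Real.log (dataDet φ lam x S))

/-- Upper confidence bound of arm `z` computed from the data set `S`. -/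
def ucb (φ : E → H) (θ : H) (lam R δ : ℝ) (N : ℕ) (x : ℕ → E) (y : ℕ → ℝ) (S : Finset ℕ) (z : E) : ℝ :=
  muHat φ lam x y S z + alpha φ θ lam R δ N x S * sigmaHat φ lam x S z

/-- The state of the system after some number of interactions. -/
structure State where
  /-- number of interactions that had taken place at the last global synchronization -/
  tLast : ℕ
  /-- `data j`: the data set `𝒟(j)` of client `j` -/
  data : ℕ → Finset ℕ
  /-- `buf j`: the upload buffer `Δ𝒟(j)` of client `j` -/
  buf : ℕ → Finset ℕ
  /-- number of global synchronizations so far -/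
  syncs : ℕ
  /-- number of scalars transferred so far -/
  cost : ℕ

/-- The state before the first interaction. -/
def State.init : State where
  tLast := 0
  data := fun _ => ∅
  buf := fun _ => ∅
  syncs := 0
  cost := 0

/-- Client `i` adds the data point of interaction `t` to its data set and to its upload buffer. -/
def State.observe (st : State) (i t : ℕ) : State :=
  { st with
    data := Function.update st.data i (insert t (st.data i))
    buf := Function.update st.buf i (insert t (st.buf i)) }

/-- The synchronization event with threshold `D`, checked by client `i`.  Right after the last
synchronization every client held exactly the first `st.tLast` data points, so `st.tLast` is the size of
its data set at that time. -/
def State.Trigger (φ : E → H) (lam D : ℝ) (x : ℕ → E) (st : State) (i : ℕ) : Prop :=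
  D < (((st.data i).card : ℝ) - st.tLast)
    * Real.log (dataDet φ lam x (st.data i) / dataDet φ lam x (st.data i \ st.buf i))

/-- Global synchronization after `n` interactions, for `N` clients and arms in dimension `d`: every
client uploads the raw data `(x_s, y_s)` of its buffer (`d + 1` scalars per data point), and the server
sends to every client the raw data that this client is missing; afterwards every client holds all `n`
data points. -/
def State.sync (N d n : ℕ) (st : State) : State where
  tLast := n
  data := fun _ => Finset.range n
  buf := fun _ => ∅
  syncs := st.syncs + 1
  cost := st.cost + (∑ j ∈ Finset.range N, (st.buf j).card * (d + 1))
    + ∑ j ∈ Finset.range N, (Finset.range n \ st.data j).card * (d + 1)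

open Classical in
/-- The state after `t` interactions, when the arms `x 0, x 1, …` are played. -/
def stateAt (φ : E → H) (lam D : ℝ) (N d : ℕ) (x : ℕ → E) : ℕ → State
  | 0 => State.init
  | t + 1 =>
    let st := (stateAt φ lam D N d x t).observe (t % N) t
    if st.Trigger φ lam D x (t % N) then st.sync N d (t + 1) else st

/-- Cumulative regret over `n` interactions for the mean reward `z ↦ ⟨θ, φ(z)⟩` and the candidate sets
`cand 0, cand 1, …`. -/
def regret (φ : E → H) (θ : H) (cand : ℕ → Set E) (x : ℕ → E) (n : ℕ) : ℝ :=
  ∑ t ∈ Finset.range n,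
    (sSup ((fun z => inner ℝ θ (φ z)) '' cand t) - inner ℝ θ (φ (x t)))

end Kernel

section Noise

variable {Ω E : Type*}

/-- The σ-algebra generated by all previous arms and noises and by the arm of interaction `t`. -/
@[reducible] def history [MeasurableSpace E] (x : ℕ → Ω → E) (η : ℕ → Ω → ℝ) (t : ℕ) : MeasurableSpace Ω :=
  (⨆ s : Fin t, (MeasurableSpace.comap (x s) inferInstance ⊔ MeasurableSpace.comap (η s) inferInstance))
    ⊔ MeasurableSpace.comap (x t) inferInstance

/-- `ξ` is conditionally zero-mean and `R`-sub-Gaussian given the σ-algebra `m`. -/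
def CondSubGaussian [MeasurableSpace Ω] (μ : Measure Ω) (m : MeasurableSpace Ω) (ξ : Ω → ℝ) (R : ℝ) :
    Prop :=
  Integrable ξ μ ∧ μ[ξ | m] =ᵐ[μ] 0 ∧
    ∀ u : ℝ, Integrable (fun ω => Real.exp (u * ξ ω)) μ ∧
      μ[fun ω => Real.exp (u * ξ ω) | m] ≤ᵐ[μ] fun _ => Real.exp (u ^ 2 * R ^ 2 / 2)

end Noise

end

end DisKernelUCB

/-!
The regret bound combines a confidence statement that holds for all data sets on which the clients act
with a deterministic bound on the confidence widths; the bounds on communication are deterministic.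

**Confidence.**  Which interactions belong to the data set of a client depends, through the random times of
the synchronizations, on the noise of all clients, and these data sets are no initial segments of the time
axis; so the usual self-normalized bound along a filtration does not apply to them.  For fixed predictable coefficients `u s`, let `m S = exp (∑ s ∈ S, (u s η s - u s ² R² / 2))`.  If the last
synchronization took place after `τ` interactions and the clients have since collected the disjoint local
data `S j`, consider the *potential*
`½ √(m (range τ)) (1 + ∑ j, m (S j) + (N - 1) ∏ j, m (S j))`.
Between synchronizations an interaction changes the local data of one client only, and the potential is
affine in each `m (S j)`, so it is a supermartingale (`setLIntegral_dirPotential_succ_le`).  A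
synchronization does not increase it, by the inequality between the arithmetic and the geometric mean
(`potential_sync_le`).  It starts at `N`, and since `2 √a ≤ 1 + a` it dominates `√(m S)` for the data set
`S = range τ ∪ S j` of every client (`exp_half_logLik_clientData_le`).

A Gaussian mixture over the coefficients turns this into a bound on the norm of the noise.  The coefficients
are `u s = c ⟨l s, ξ⟩`, where `l s` are the coordinates of the feature of arm `s` in the Gram–Schmidt basis
of the features of the arms so far: they are predictable and have Gram matrix `K`.  The integral of
`√(m S)` over `ξ` is `exp (ηᵀ K (K + lam)⁻¹ η / (4 R²)) / √det (1 + K / lam)`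
(`lintegral_exp_half_logLik`), and Ville's inequality with level `N / δ` gives exactly the noise part of
`alpha` (`measure_exists_not_noiseBounded_le`).

**Regret.**  On the event of valid confidence intervals, the regret of an interaction is at most twice
`alpha` times its confidence width.  Call an epoch, the interactions from one
synchronization to the next, good if the information `log det` grows by at most `1` in it.  In a good epoch,
the widths are comparable to those computed from all previous data, and the elliptical potential lemma
applies to all good epochs together.  There are at most `2 γ` other epochs, and in each of them every client
has total width at most of order `√D`, up to its last interaction, since it did not trigger a
synchronization (`sum_playedWidth_le`).  The bound `½ log (1 + N T κ² / lam) ≤ γ` absorbs `log (N / δ)`.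

**Communication.**  A synchronization after epoch `k` means `D < n k * h k`, with `n k` the number of data
points that the triggering client collected and `h k` the growth of the information.  A client carries out
one in `N` interactions, so `∑ n k ≤ T + B`, and `∑ h k ≤ 2 γ`; the Cauchy–Schwarz inequality gives
`B² D ≤ 2 γ (T + B)` (`syncs_le`).  Every data point is transferred to or from each client at most once, so
the cost is at most `N * (N T) * (d + 1)`.
-/

namespace DisKernelUCB

noncomputable section

/-! ### Ridge regression in the feature space -/

section Ridge

variable {E H : Type*} [NormedAddCommGroup H] [InnerProductSpace ℝ H]

theorem kernel_comm (φ : E → H) (a b : E) : kernel φ a b = kernel φ b a :=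
  real_inner_comm _ _

theorem kernelMatrix_eq_gram {ι : Type*} (φ : E → H) (z : ι → E) :
    kernelMatrix φ z = Matrix.gram ℝ fun i => φ (z i) := rfl

theorem posDef_kernelMatrix_add {ι : Type*} [Fintype ι] [DecidableEq ι] (φ : E → H) {lam : ℝ}
    (hlam : 0 < lam) (z : ι → E) :
    (kernelMatrix φ z + lam • (1 : Matrix ι ι ℝ)).PosDef := by
  rw [kernelMatrix_eq_gram]
  exact Matrix.PosDef.posSemidef_add (Matrix.posSemidef_gram _ _) (Matrix.PosDef.one.smul hlam)

theorem posDef_one_add_kernelMatrix {ι : Type*} [Fintype ι] [DecidableEq ι] (φ : E → H) {lam : ℝ}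
    (hlam : 0 < lam) (z : ι → E) :
    (1 + lam⁻¹ • kernelMatrix φ z).PosDef := by
  rw [kernelMatrix_eq_gram]
  exact Matrix.PosDef.one.add_posSemidef
    ((Matrix.posSemidef_gram _ _).smul (inv_nonneg.2 hlam.le))

/-- The bilinear form `⟨w, V w'⟩` of the regularised design operator
`V = lam + ∑ s ∈ S, φ(x s) ⊗ φ(x s)`. -/
def precForm (φ : E → H) (lam : ℝ) (x : ℕ → E) (S : Finset ℕ) (w w' : H) : ℝ :=
  lam * inner ℝ w w' + ∑ s ∈ S, inner ℝ (φ (x s)) w * inner ℝ (φ (x s)) w'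

theorem precForm_comm (φ : E → H) (lam : ℝ) (x : ℕ → E) (S : Finset ℕ) (w w' : H) :
    precForm φ lam x S w w' = precForm φ lam x S w' w := by
  simp only [precForm, real_inner_comm w w', mul_comm (inner ℝ (φ (x _)) w)]

theorem precForm_smul_right (φ : E → H) (lam : ℝ) (x : ℕ → E) (S : Finset ℕ) (w w' : H) (c : ℝ) :
    precForm φ lam x S w (c • w') = c * precForm φ lam x S w w' := by
  simp only [precForm, inner_smul_right, mul_add, Finset.mul_sum]
  congr 1
  · ring
  · exact Finset.sum_congr rfl fun s _ => by ring

theorem precForm_add_right (φ : E → H) (lam : ℝ) (x : ℕ → E) (S : Finset ℕ) (w a b : H) :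
    precForm φ lam x S w (a + b) = precForm φ lam x S w a + precForm φ lam x S w b := by
  simp only [precForm, inner_add_right, mul_add, Finset.sum_add_distrib]
  ring

theorem mul_norm_sq_le_precForm (φ : E → H) (lam : ℝ) (x : ℕ → E) (S : Finset ℕ) (w : H) :
    lam * ‖w‖ ^ 2 ≤ precForm φ lam x S w w := by
  rw [precForm, real_inner_self_eq_norm_sq]
  have : 0 ≤ ∑ s ∈ S, inner ℝ (φ (x s)) w * inner ℝ (φ (x s)) w :=
    Finset.sum_nonneg fun s _ => mul_self_nonneg _
  linarith

theorem precForm_self_nonneg (φ : E → H) {lam : ℝ} (hlam : 0 < lam) (x : ℕ → E) (S : Finset ℕ)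
    (w : H) : 0 ≤ precForm φ lam x S w w :=
  le_trans (by positivity) (mul_norm_sq_le_precForm φ lam x S w)

/-- Cauchy–Schwarz inequality for the form `⟨w, V w'⟩`. -/
theorem precForm_sq_le (φ : E → H) {lam : ℝ} (hlam : 0 < lam) (x : ℕ → E) (S : Finset ℕ)
    (w w' : H) :
    precForm φ lam x S w w' ^ 2 ≤ precForm φ lam x S w w * precForm φ lam x S w' w' := by
  have key : ∀ c : ℝ, 0 ≤ precForm φ lam x S w w * (c * c)
      + 2 * precForm φ lam x S w w' * c + precForm φ lam x S w' w' := by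
    intro c
    have h := precForm_self_nonneg φ hlam x S (c • w + w')
    rw [precForm_add_right, precForm_smul_right, precForm_comm φ lam x S _ w,
      precForm_comm φ lam x S _ w', precForm_add_right, precForm_add_right, precForm_smul_right,
      precForm_smul_right, precForm_comm φ lam x S w' w] at h
    linarith
  have := discrim_le_zero key
  rw [discrim] at this
  nlinarith

theorem abs_precForm_le (φ : E → H) {lam : ℝ} (hlam : 0 < lam) (x : ℕ → E) (S : Finset ℕ)
    (w w' : H) :
    |precForm φ lam x S w w'|
      ≤ Real.sqrt (precForm φ lam x S w w) * Real.sqrt (precForm φ lam x S w' w') := by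
  rw [← Real.sqrt_mul (precForm_self_nonneg φ hlam x S w)]
  exact Real.abs_le_sqrt (precForm_sq_le φ hlam x S w w')

theorem mulVec_ridgeInv_mulVec (φ : E → H) {lam : ℝ} (hlam : 0 < lam) (x : ℕ → E) (S : Finset ℕ)
    (y : S → ℝ) (s : S) :
    ∑ r : S, kernel φ (x s) (x r) * (ridgeInv φ lam x S).mulVec y r
      = y s - lam * (ridgeInv φ lam x S).mulVec y s := by
  have hu : IsUnit (kernelMatrix φ (fun s : S => x s) + lam • (1 : Matrix S S ℝ)).det :=
    (posDef_kernelMatrix_add φ hlam fun s : S => x s).det_pos.ne'.isUnit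
  have h : (kernelMatrix φ (fun s : S => x s) + lam • (1 : Matrix S S ℝ)).mulVec
      ((ridgeInv φ lam x S).mulVec y) = y := by
    rw [Matrix.mulVec_mulVec, ridgeInv, Matrix.mul_nonsing_inv _ hu, Matrix.one_mulVec]
  have h' := congrFun h s
  rw [Matrix.add_mulVec, Matrix.smul_mulVec, Matrix.one_mulVec] at h'
  simp only [Pi.add_apply, Pi.smul_apply, smul_eq_mul, Matrix.mulVec, dotProduct, kernelMatrix,
    Matrix.of_apply] at h'
  simp only [Matrix.mulVec, dotProduct]
  linarith

/-- The ridge estimate `V⁻¹ ∑ s ∈ S, y s • φ(x s)` in the feature space. -/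
def ridgeEst (φ : E → H) (lam : ℝ) (x : ℕ → E) (y : ℕ → ℝ) (S : Finset ℕ) : H :=
  ∑ s : S, (ridgeInv φ lam x S).mulVec (fun s : S => y s) s • φ (x s)

/-- The vector `V⁻¹ φ(z)`, written through the kernel. -/
def resolvent (φ : E → H) (lam : ℝ) (x : ℕ → E) (S : Finset ℕ) (z : E) : H :=
  lam⁻¹ • (φ z - ∑ s : S, (ridgeInv φ lam x S).mulVec (kernelVec φ x S z) s • φ (x s))

/-- The posterior variance `⟨φ(z), V⁻¹ φ(z)⟩`, the square of `sigmaHat`. -/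
def postVar (φ : E → H) (lam : ℝ) (x : ℕ → E) (S : Finset ℕ) (z : E) : ℝ :=
  lam⁻¹ * (kernel φ z z
    - kernelVec φ x S z ⬝ᵥ (ridgeInv φ lam x S).mulVec (kernelVec φ x S z))

theorem precForm_ridgeEst (φ : E → H) {lam : ℝ} (hlam : 0 < lam) (x : ℕ → E) (y : ℕ → ℝ)
    (S : Finset ℕ) (w : H) :
    precForm φ lam x S w (ridgeEst φ lam x y S) = ∑ s ∈ S, y s * inner ℝ (φ (x s)) w := by
  have h1 : ∀ s : S, inner ℝ (φ (x s)) (ridgeEst φ lam x y S)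
      = y s - lam * (ridgeInv φ lam x S).mulVec (fun s : S => y s) s := by
    intro s
    rw [← mulVec_ridgeInv_mulVec φ hlam x S (fun s : S => y s) s, ridgeEst, inner_sum]
    exact Finset.sum_congr rfl fun r _ => by rw [inner_smul_right, kernel, mul_comm]
  rw [precForm, ← Finset.sum_coe_sort S fun s => inner ℝ (φ (x s)) w
      * inner ℝ (φ (x s)) (ridgeEst φ lam x y S), ← Finset.sum_coe_sort S fun s => y s * _]
  simp only [h1]
  rw [ridgeEst, inner_sum, Finset.mul_sum, ← Finset.sum_add_distrib]
  refine Finset.sum_congr rfl fun s _ => ?_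
  rw [inner_smul_right, real_inner_comm]
  ring

theorem precForm_resolvent (φ : E → H) {lam : ℝ} (hlam : 0 < lam) (x : ℕ → E)
    (S : Finset ℕ) (z : E) (w : H) :
    precForm φ lam x S w (resolvent φ lam x S z) = inner ℝ w (φ z) := by
  have h1 : ∀ s : S, inner ℝ (φ (x s)) (resolvent φ lam x S z)
      = (ridgeInv φ lam x S).mulVec (kernelVec φ x S z) s := by
    intro s
    have h := mulVec_ridgeInv_mulVec φ hlam x S (kernelVec φ x S z) s
    rw [resolvent, inner_smul_right, inner_sub_right, inner_sum]
    have : ∑ r : S, inner ℝ (φ (x s))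
        ((ridgeInv φ lam x S).mulVec (kernelVec φ x S z) r • φ (x r))
        = ∑ r : S, kernel φ (x s) (x r) * (ridgeInv φ lam x S).mulVec (kernelVec φ x S z) r :=
      Finset.sum_congr rfl fun r _ => by rw [inner_smul_right, kernel, mul_comm]
    rw [this, h, kernelVec, kernel]
    field_simp
    ring
  rw [precForm, ← Finset.sum_coe_sort S fun s => inner ℝ (φ (x s)) w
      * inner ℝ (φ (x s)) (resolvent φ lam x S z)]
  simp only [h1]
  rw [resolvent, inner_smul_right, inner_sub_right, inner_sum, mul_inv_cancel_left₀ hlam.ne']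
  simp only [inner_smul_right]
  have : ∀ s : S, inner ℝ (φ (x s)) w * (ridgeInv φ lam x S).mulVec (kernelVec φ x S z) s
      = (ridgeInv φ lam x S).mulVec (kernelVec φ x S z) s * inner ℝ w (φ (x s)) := fun s => by
    rw [real_inner_comm, mul_comm]
  simp only [this]
  ring

theorem postVar_eq_inner (φ : E → H) (lam : ℝ) (x : ℕ → E) (S : Finset ℕ) (z : E) :
    postVar φ lam x S z = inner ℝ (resolvent φ lam x S z) (φ z) := by
  rw [postVar, resolvent, inner_smul_left, inner_sub_left, sum_inner]
  simp only [inner_smul_left, dotProduct, kernelVec, kernel, RCLike.conj_to_real]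
  congr 2
  exact Finset.sum_congr rfl fun s _ => mul_comm _ _

theorem postVar_eq_precForm (φ : E → H) {lam : ℝ} (hlam : 0 < lam) (x : ℕ → E) (S : Finset ℕ)
    (z : E) :
    postVar φ lam x S z
      = precForm φ lam x S (resolvent φ lam x S z) (resolvent φ lam x S z) := by
  rw [precForm_resolvent φ hlam, postVar_eq_inner]

theorem postVar_nonneg (φ : E → H) {lam : ℝ} (hlam : 0 < lam) (x : ℕ → E) (S : Finset ℕ)
    (z : E) : 0 ≤ postVar φ lam x S z := by
  rw [postVar_eq_precForm φ hlam]
  exact precForm_self_nonneg φ hlam x S _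

theorem sigmaHat_eq_sqrt (φ : E → H) {lam : ℝ} (hlam : 0 < lam) (x : ℕ → E) (S : Finset ℕ)
    (z : E) : sigmaHat φ lam x S z = Real.sqrt (postVar φ lam x S z) := by
  rw [sigmaHat, postVar, Real.sqrt_mul (inv_nonneg.2 hlam.le), Real.sqrt_inv]

theorem sigmaHat_nonneg (φ : E → H) (lam : ℝ) (x : ℕ → E) (S : Finset ℕ)
    (z : E) : 0 ≤ sigmaHat φ lam x S z :=
  mul_nonneg (inv_nonneg.2 (Real.sqrt_nonneg _)) (Real.sqrt_nonneg _)

theorem sigmaHat_sq (φ : E → H) {lam : ℝ} (hlam : 0 < lam) (x : ℕ → E) (S : Finset ℕ)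
    (z : E) : sigmaHat φ lam x S z ^ 2 = postVar φ lam x S z := by
  rw [sigmaHat_eq_sqrt φ hlam, Real.sq_sqrt (postVar_nonneg φ hlam x S z)]

theorem muHat_eq_inner (φ : E → H) (lam : ℝ) (x : ℕ → E) (y : ℕ → ℝ) (S : Finset ℕ) (z : E) :
    muHat φ lam x y S z = inner ℝ (ridgeEst φ lam x y S) (φ z) := by
  rw [muHat, ridgeEst, sum_inner]
  simp only [inner_smul_left, dotProduct, kernelVec, kernel, RCLike.conj_to_real]
  exact Finset.sum_congr rfl fun s _ => mul_comm _ _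

/-- The variational lower bound
`2 ⟨w, φ(z)⟩ - ⟨w, V w⟩ ≤ ⟨φ(z), V⁻¹ φ(z)⟩`, with equality at `w = V⁻¹ φ(z)`. -/
theorem le_postVar (φ : E → H) {lam : ℝ} (hlam : 0 < lam) (x : ℕ → E) (S : Finset ℕ) (z : E)
    (w : H) : 2 * inner ℝ w (φ z) - precForm φ lam x S w w ≤ postVar φ lam x S z := by
  have h := precForm_self_nonneg φ hlam x S (resolvent φ lam x S z + (-1 : ℝ) • w)
  rw [precForm_add_right, precForm_smul_right, precForm_comm φ lam x S _ w,
    precForm_comm φ lam x S _ (resolvent φ lam x S z), precForm_add_right, precForm_add_right,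
    precForm_smul_right, precForm_smul_right, precForm_comm φ lam x S _ w,
    ← postVar_eq_precForm φ hlam, precForm_resolvent φ hlam] at h
  linarith

theorem postVar_le (φ : E → H) {lam : ℝ} (hlam : 0 < lam) (x : ℕ → E) (S : Finset ℕ) (z : E) :
    postVar φ lam x S z ≤ ‖φ z‖ ^ 2 / lam := by
  have h1 := mul_norm_sq_le_precForm φ lam x S (resolvent φ lam x S z)
  rw [← postVar_eq_precForm φ hlam] at h1
  have h2 : postVar φ lam x S z ≤ ‖resolvent φ lam x S z‖ * ‖φ z‖ := by
    rw [postVar_eq_inner]; exact real_inner_le_norm _ _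
  have h3 : 0 ≤ (lam * ‖resolvent φ lam x S z‖ - ‖φ z‖) ^ 2 := sq_nonneg _
  rw [le_div_iff₀ hlam]
  nlinarith [mul_le_mul_of_nonneg_left h2 hlam.le, mul_le_mul_of_nonneg_left h1 hlam.le]

/-- Observing one more arm divides the posterior variance by at most `1 +` the posterior variance of
that arm. -/
theorem postVar_le_postVar_insert (φ : E → H) {lam : ℝ} (hlam : 0 < lam) (x : ℕ → E)
    {S : Finset ℕ} {s : ℕ} (hs : s ∉ S) (z : E) :
    postVar φ lam x S z ≤ (1 + postVar φ lam x S (x s)) * postVar φ lam x (insert s S) z := by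
  set p := postVar φ lam x S z with hp
  set q := postVar φ lam x S (x s) with hq
  have hp0 : 0 ≤ p := postVar_nonneg φ hlam x S z
  have hq0 : 0 ≤ q := postVar_nonneg φ hlam x S (x s)
  set r := resolvent φ lam x S z with hr
  have hins : ∀ w : H, precForm φ lam x (insert s S) w w
      = precForm φ lam x S w w + inner ℝ (φ (x s)) w ^ 2 := by
    intro w
    rw [precForm, precForm, Finset.sum_insert hs]
    ring
  have hcs : inner ℝ (φ (x s)) r ^ 2 ≤ p * q := by
    have h := precForm_sq_le φ hlam x S r (resolvent φ lam x S (x s))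
    rw [precForm_resolvent φ hlam, ← postVar_eq_precForm φ hlam, hr,
      ← postVar_eq_precForm φ hlam, real_inner_comm] at h
    exact h
  -- the test vector `(1 + q)⁻¹ • V⁻¹ φ(z)` is the best multiple of `V⁻¹ φ(z)`
  have h := le_postVar φ hlam x (insert s S) z ((1 + q)⁻¹ • r)
  rw [hins, precForm_smul_right, precForm_comm, precForm_smul_right, inner_smul_left,
    inner_smul_right, hr, ← postVar_eq_inner, ← postVar_eq_precForm φ hlam, ← hp,
    RCLike.conj_to_real, ← hr] at h
  have h1 : (1 + q)⁻¹ * p ≤ postVar φ lam x (insert s S) z := by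
    refine le_trans ?_ h
    have hq1 : (1 + q)⁻¹ * (1 + q) = 1 := inv_mul_cancel₀ (by positivity)
    have h2 : ((1 + q)⁻¹ * inner ℝ (φ (x s)) r) ^ 2 ≤ (1 + q)⁻¹ ^ 2 * (p * q) := by
      rw [mul_pow]
      exact mul_le_mul_of_nonneg_left hcs (by positivity)
    have h3 : (1 + q)⁻¹ ^ 2 * (p * q) = (1 + q)⁻¹ * p - (1 + q)⁻¹ * ((1 + q)⁻¹ * p) := by
      have : (1 + q)⁻¹ * p - (1 + q)⁻¹ * ((1 + q)⁻¹ * p)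
          = (1 + q)⁻¹ * p * ((1 + q)⁻¹ * (1 + q)) - (1 + q)⁻¹ * ((1 + q)⁻¹ * p) := by
        rw [hq1, mul_one]
      rw [this]; ring
    linarith
  calc p = (1 + q) * ((1 + q)⁻¹ * p) := by field_simp
    _ ≤ _ := mul_le_mul_of_nonneg_left h1 (by positivity)

/-- The squared norm `ηᵀ K (K + lam)⁻¹ η` of the noise vector `∑ s ∈ S, η s • φ(x s)` with respect to
`V⁻¹`. -/
def noiseForm (φ : E → H) (lam : ℝ) (x : ℕ → E) (η : ℕ → ℝ) (S : Finset ℕ) : ℝ :=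
  precForm φ lam x S (ridgeEst φ lam x η S) (ridgeEst φ lam x η S)

/-- The estimation error of ridge regression: a bias term and a noise term. -/
theorem abs_muHat_sub_le (φ : E → H) {lam : ℝ} (hlam : 0 < lam) (θ : H) (x : ℕ → E)
    (y η : ℕ → ℝ) (S : Finset ℕ) (hy : ∀ s ∈ S, y s = inner ℝ θ (φ (x s)) + η s) (z : E) :
    |muHat φ lam x y S z - inner ℝ θ (φ z)|
      ≤ (Real.sqrt lam * ‖θ‖ + Real.sqrt (noiseForm φ lam x η S)) * sigmaHat φ lam x S z := by
  set r := resolvent φ lam x S z with hr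
  have h1 : muHat φ lam x y S z = ∑ s ∈ S, y s * inner ℝ (φ (x s)) r := by
    rw [← precForm_ridgeEst φ hlam, precForm_comm, hr, precForm_resolvent φ hlam, muHat_eq_inner]
  have h2 : ∑ s ∈ S, y s * inner ℝ (φ (x s)) r
      = precForm φ lam x S r θ - lam * inner ℝ r θ
        + precForm φ lam x S r (ridgeEst φ lam x η S) := by
    rw [precForm_ridgeEst φ hlam, precForm, add_sub_cancel_left, ← Finset.sum_add_distrib]
    refine Finset.sum_congr rfl fun s hs => ?_
    rw [hy s hs, real_inner_comm θ]
    ring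
  have h3 : precForm φ lam x S r θ = inner ℝ θ (φ z) := by
    rw [precForm_comm, hr, precForm_resolvent φ hlam]
  have h4 : |precForm φ lam x S r (ridgeEst φ lam x η S)|
      ≤ sigmaHat φ lam x S z * Real.sqrt (noiseForm φ lam x η S) := by
    have := abs_precForm_le φ hlam x S r (ridgeEst φ lam x η S)
    rwa [hr, ← postVar_eq_precForm φ hlam, ← sigmaHat_eq_sqrt φ hlam] at this
  have h5 : |lam * inner ℝ r θ| ≤ Real.sqrt lam * ‖θ‖ * sigmaHat φ lam x S z := by
    have h6 : Real.sqrt lam * ‖r‖ ≤ sigmaHat φ lam x S z := by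
      rw [sigmaHat_eq_sqrt φ hlam]
      apply Real.le_sqrt_of_sq_le
      rw [mul_pow, Real.sq_sqrt hlam.le, postVar_eq_precForm φ hlam]
      exact mul_norm_sq_le_precForm φ lam x S r
    rw [abs_mul, abs_of_pos hlam]
    calc lam * |inner ℝ r θ| ≤ lam * (‖r‖ * ‖θ‖) :=
          mul_le_mul_of_nonneg_left (abs_real_inner_le_norm _ _) hlam.le
      _ = Real.sqrt lam * ‖θ‖ * (Real.sqrt lam * ‖r‖) := by
          nth_rewrite 1 [← Real.mul_self_sqrt hlam.le]; ring
      _ ≤ _ := mul_le_mul_of_nonneg_left h6 (by positivity)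
  rw [h1, h2, h3]
  calc |inner ℝ θ (φ z) - lam * inner ℝ r θ + precForm φ lam x S r (ridgeEst φ lam x η S)
        - inner ℝ θ (φ z)|
      = |precForm φ lam x S r (ridgeEst φ lam x η S) - lam * inner ℝ r θ| := by
        congr 1; ring
    _ ≤ |precForm φ lam x S r (ridgeEst φ lam x η S)| + |lam * inner ℝ r θ| := abs_sub _ _
    _ ≤ _ := by linarith

end Ridge

/-! ### Log-determinants and the maximum information gain -/

section InfoGain

variable {E H : Type*} [NormedAddCommGroup H] [InnerProductSpace ℝ H]

theorem infoDet_comp_equiv {ι κ : Type*} [Fintype ι] [DecidableEq ι] [Fintype κ] [DecidableEq κ]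
    (φ : E → H) (lam : ℝ) (z : ι → E) (e : κ ≃ ι) :
    infoDet φ lam (fun i => z (e i)) = infoDet φ lam z := by
  rw [infoDet, infoDet, ← Matrix.det_submatrix_equiv_self e]
  congr 1
  ext i j
  simp [kernelMatrix, Matrix.one_apply]

theorem infoDet_pos {ι : Type*} [Fintype ι] [DecidableEq ι] (φ : E → H) {lam : ℝ}
    (hlam : 0 < lam) (z : ι → E) : 0 < infoDet φ lam z :=
  (posDef_one_add_kernelMatrix φ hlam z).det_pos

theorem dataDet_pos (φ : E → H) {lam : ℝ} (hlam : 0 < lam) (x : ℕ → E) (S : Finset ℕ) :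
    0 < dataDet φ lam x S := infoDet_pos φ hlam _

theorem dataDet_empty (φ : E → H) (lam : ℝ) (x : ℕ → E) : dataDet φ lam x ∅ = 1 := by
  rw [dataDet, infoDet]
  exact Matrix.det_isEmpty

/-- The determinant update: the Schur complement of the new diagonal entry is
`1 +` the posterior variance of the new arm. -/
theorem dataDet_insert (φ : E → H) {lam : ℝ} (hlam : 0 < lam) (x : ℕ → E) {S : Finset ℕ} {s : ℕ}
    (hs : s ∉ S) :
    dataDet φ lam x (insert s S) = dataDet φ lam x S * (1 + postVar φ lam x S (x s)) := by
  set e : S ⊕ PUnit.{1} ≃ (insert s S : Finset ℕ) :=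
    ((Finset.subtypeInsertEquivOption hs).trans (Equiv.optionEquivSumPUnit _)).symm
  have hel : ∀ i : S, ((e (Sum.inl i) : (insert s S : Finset ℕ)) : ℕ) = i := fun i => rfl
  have her : ∀ i, ((e (Sum.inr i) : (insert s S : Finset ℕ)) : ℕ) = s := fun i => rfl
  rw [dataDet, ← infoDet_comp_equiv φ lam _ e, dataDet]
  set A : Matrix S S ℝ := 1 + lam⁻¹ • kernelMatrix φ fun s : S => x s with hA
  have hAu : IsUnit A.det := (posDef_one_add_kernelMatrix φ hlam fun s : S => x s).det_pos.ne'.isUnit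
  have hblock : (1 + lam⁻¹ • kernelMatrix φ fun i => x (e i))
      = Matrix.fromBlocks A (Matrix.replicateCol PUnit (lam⁻¹ • kernelVec φ x S (x s)))
        (Matrix.replicateRow PUnit (lam⁻¹ • kernelVec φ x S (x s)))
        (1 + lam⁻¹ • Matrix.of fun _ _ => kernel φ (x s) (x s)) := by
    ext i j
    rcases i with i | i <;> rcases j with j | j
    · simp [kernelMatrix, hA, hel, Matrix.one_apply]
    · simp [kernelMatrix, hel, her, kernelVec]
    · simp [kernelMatrix, hel, her, kernelVec, kernel_comm φ (x s)]
    · simp [kernelMatrix, her]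
  have hinv : A⁻¹ = lam • ridgeInv φ lam x S := by
    apply Matrix.inv_eq_right_inv
    have hu : IsUnit (kernelMatrix φ (fun s : S => x s) + lam • (1 : Matrix S S ℝ)).det :=
      (posDef_kernelMatrix_add φ hlam fun s : S => x s).det_pos.ne'.isUnit
    have : A = lam⁻¹ • (kernelMatrix φ (fun s : S => x s) + lam • (1 : Matrix S S ℝ)) := by
      rw [hA, smul_add, smul_smul, inv_mul_cancel₀ hlam.ne', one_smul, add_comm]
    rw [this, ridgeInv, Matrix.smul_mul, Matrix.mul_smul, smul_smul, inv_mul_cancel₀ hlam.ne',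
      one_smul, Matrix.mul_nonsing_inv _ hu]
  have := Matrix.invertibleOfIsUnitDet A hAu
  rw [infoDet, hblock, Matrix.det_fromBlocks₁₁, infoDet, Matrix.invOf_eq_nonsing_inv, hinv]
  congr 1
  rw [Matrix.det_unique, Matrix.mul_assoc, Matrix.smul_mul, Matrix.mul_smul]
  simp only [Matrix.sub_apply, Matrix.add_apply, Matrix.smul_apply, Matrix.one_apply_eq,
    Matrix.of_apply, smul_eq_mul]
  have : (Matrix.replicateRow PUnit.{1} (lam⁻¹ • kernelVec φ x S (x s))
      * (ridgeInv φ lam x S * Matrix.replicateCol PUnit.{1} (lam⁻¹ • kernelVec φ x S (x s))))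
      default default = lam⁻¹ * (lam⁻¹ * (kernelVec φ x S (x s)
        ⬝ᵥ (ridgeInv φ lam x S).mulVec (kernelVec φ x S (x s)))) := by
    rw [← Matrix.replicateCol_mulVec, Matrix.replicateRow_mul_replicateCol_apply,
      Matrix.mulVec_smul, dotProduct_smul, smul_dotProduct, smul_eq_mul, smul_eq_mul]
  rw [this, postVar]
  field_simp
  ring

theorem dataDet_mono (φ : E → H) {lam : ℝ} (hlam : 0 < lam) (x : ℕ → E) :
    Monotone (dataDet φ lam x) := by
  refine Finset.monotone_iff_forall_le_insert.2 fun S s hs => ?_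
  rw [dataDet_insert φ hlam x hs]
  nlinarith [dataDet_pos φ hlam x S, postVar_nonneg φ hlam x S (x s)]

/-- The product of the determinant and a posterior variance grows with the data set, so a posterior
variance shrinks at most by the ratio of the determinants. -/
theorem dataDet_mul_postVar_mono (φ : E → H) {lam : ℝ} (hlam : 0 < lam) (x : ℕ → E) (z : E) :
    Monotone fun S => dataDet φ lam x S * postVar φ lam x S z := by
  refine Finset.monotone_iff_forall_le_insert.2 fun S s hs => ?_
  rw [dataDet_insert φ hlam x hs, mul_assoc]
  exact mul_le_mul_of_nonneg_left (postVar_le_postVar_insert φ hlam x hs z)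
    (dataDet_pos φ hlam x S).le

theorem one_le_dataDet (φ : E → H) {lam : ℝ} (hlam : 0 < lam) (x : ℕ → E) (S : Finset ℕ) :
    1 ≤ dataDet φ lam x S := by
  rw [← dataDet_empty φ lam x]
  exact dataDet_mono φ hlam x (Finset.empty_subset S)

/-- The information `log det (I + K_{S,S} / lam)` of a data set. -/
def info (φ : E → H) (lam : ℝ) (x : ℕ → E) (S : Finset ℕ) : ℝ :=
  Real.log (dataDet φ lam x S)

theorem info_mono (φ : E → H) {lam : ℝ} (hlam : 0 < lam) (x : ℕ → E) :
    Monotone (info φ lam x) := fun S _ h =>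
  Real.log_le_log (dataDet_pos φ hlam x S) (dataDet_mono φ hlam x h)

theorem info_empty (φ : E → H) (lam : ℝ) (x : ℕ → E) : info φ lam x ∅ = 0 := by
  rw [info, dataDet_empty, Real.log_one]

theorem info_nonneg (φ : E → H) {lam : ℝ} (hlam : 0 < lam) (x : ℕ → E) (S : Finset ℕ) :
    0 ≤ info φ lam x S := Real.log_nonneg (one_le_dataDet φ hlam x S)

theorem info_insert (φ : E → H) {lam : ℝ} (hlam : 0 < lam) (x : ℕ → E) {S : Finset ℕ} {s : ℕ}
    (hs : s ∉ S) :
    info φ lam x (insert s S)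
      = info φ lam x S + Real.log (1 + postVar φ lam x S (x s)) := by
  have := postVar_nonneg φ hlam x S (x s)
  rw [info, dataDet_insert φ hlam x hs,
    Real.log_mul (dataDet_pos φ hlam x S).ne' (by positivity), info]

theorem log_dataDet_div (φ : E → H) {lam : ℝ} (hlam : 0 < lam) (x : ℕ → E) (S S' : Finset ℕ) :
    Real.log (dataDet φ lam x S / dataDet φ lam x S') = info φ lam x S - info φ lam x S' :=
  Real.log_div (dataDet_pos φ hlam x S).ne' (dataDet_pos φ hlam x S').ne'

theorem postVar_le_exp_mul (φ : E → H) {lam : ℝ} (hlam : 0 < lam) (x : ℕ → E) {S S' : Finset ℕ}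
    (h : S ⊆ S') (z : E) :
    postVar φ lam x S z
      ≤ Real.exp (info φ lam x S' - info φ lam x S) * postVar φ lam x S' z := by
  have h1 := dataDet_mul_postVar_mono φ hlam x z h
  simp only at h1
  rw [Real.exp_sub, info, info, Real.exp_log (dataDet_pos φ hlam x S'),
    Real.exp_log (dataDet_pos φ hlam x S), div_mul_eq_mul_div,
    le_div_iff₀ (dataDet_pos φ hlam x S), mul_comm]
  exact h1

/-- A posterior variance of an arm of feature norm at most `L` is at most `1 + L ^ 2 / lam` times the
information that the arm contributes. -/
theorem postVar_le_mul_log (φ : E → H) {lam L : ℝ} (hlam : 0 < lam) (x : ℕ → E)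
    (S : Finset ℕ) {z : E} (hz : ‖φ z‖ ≤ L) :
    postVar φ lam x S z ≤ (1 + L ^ 2 / lam) * Real.log (1 + postVar φ lam x S z) := by
  set p := postVar φ lam x S z
  have hp : 0 ≤ p := postVar_nonneg φ hlam x S z
  have hpL : p ≤ L ^ 2 / lam := (postVar_le φ hlam x S z).trans (by gcongr)
  have h1 := Real.one_sub_inv_le_log_of_pos (show 0 < 1 + p by positivity)
  calc p = (1 + p) * (1 - (1 + p)⁻¹) := by field_simp; ring
    _ ≤ (1 + p) * Real.log (1 + p) := mul_le_mul_of_nonneg_left h1 (by positivity)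
    _ ≤ _ := mul_le_mul_of_nonneg_right (by linarith) (Real.log_nonneg (by linarith))

theorem info_range_le (φ : E → H) {lam L : ℝ} (hlam : 0 < lam) (x : ℕ → E) (n : ℕ)
    (hx : ∀ s < n, ‖φ (x s)‖ ≤ L) : info φ lam x (Finset.range n) ≤ n * (L ^ 2 / lam) := by
  induction n with
  | zero => simp [info_empty]
  | succ n ih =>
    rw [Finset.range_add_one, info_insert φ hlam x Finset.notMem_range_self]
    have h1 := ih fun s hs => hx s (hs.trans (Nat.lt_succ_self n))
    have h2 : postVar φ lam x (Finset.range n) (x n) ≤ L ^ 2 / lam :=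
      (postVar_le φ hlam x _ _).trans (by gcongr; exact hx n (Nat.lt_succ_self n))
    have h3 := Real.log_le_sub_one_of_pos
      (show 0 < 1 + postVar φ lam x (Finset.range n) (x n) by
        have := postVar_nonneg φ hlam x (Finset.range n) (x n); positivity)
    push_cast
    linarith

theorem log_infoDet_eq_info (φ : E → H) (lam : ℝ) (x : ℕ → E) (n : ℕ) :
    Real.log (infoDet φ lam fun i : Fin n => x i) = info φ lam x (Finset.range n) := by
  rw [info, dataDet]
  let e : Fin n ≃ (Finset.range n : Finset ℕ) :=
    ⟨fun i => ⟨i, Finset.mem_range.2 i.2⟩, fun s => ⟨s, Finset.mem_range.1 s.2⟩,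
      fun _ => rfl, fun _ => rfl⟩
  exact congrArg Real.log (infoDet_comp_equiv φ lam (fun s : (Finset.range n : Finset ℕ) => x s) e)

theorem log_infoDet_le (φ : E → H) {lam L : ℝ} (hlam : 0 < lam) {A : Set E}
    (hA : ∀ z ∈ A, ‖φ z‖ ≤ L) (n : ℕ) (z : Fin n → A) :
    Real.log (infoDet φ lam fun i => (z i : E)) ≤ n * (L ^ 2 / lam) := by
  rcases Nat.eq_zero_or_pos n with rfl | hn
  · simp [infoDet]
  · let x : ℕ → E := fun s => if h : s < n then z ⟨s, h⟩ else z ⟨0, hn⟩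
    have hx : (fun i : Fin n => (z i : E)) = fun i : Fin n => x i := by
      funext i
      simp [x]
    rw [hx, log_infoDet_eq_info]
    refine info_range_le φ hlam x n fun s hs => ?_
    simp only [x, hs, dite_true]
    exact hA _ (z ⟨s, hs⟩).2

theorem bddAbove_infoGain (φ : E → H) {lam L : ℝ} (hlam : 0 < lam) {A : Set E}
    (hA : ∀ z ∈ A, ‖φ z‖ ≤ L) (n : ℕ) :
    BddAbove (Set.range fun z : Fin n → A => (1 / 2) * Real.log (infoDet φ lam fun i => (z i : E))) := by
  refine ⟨(1 / 2) * (n * (L ^ 2 / lam)), ?_⟩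
  rintro _ ⟨z, rfl⟩
  have := log_infoDet_le φ hlam hA n z
  simp only
  linarith

theorem maxInfoGain_le (φ : E → H) {lam L : ℝ} (hlam : 0 < lam) {A : Set E}
    (hA : ∀ z ∈ A, ‖φ z‖ ≤ L) (n : ℕ) :
    maxInfoGain φ lam A n ≤ (1 / 2) * (n * (L ^ 2 / lam)) := by
  refine Real.iSup_le (fun z => ?_) (by positivity)
  have := log_infoDet_le φ hlam hA n z
  linarith

theorem info_le_two_mul_maxInfoGain (φ : E → H) {lam L : ℝ} (hlam : 0 < lam) {A : Set E}
    (hA : ∀ z ∈ A, ‖φ z‖ ≤ L) (x : ℕ → E) (n : ℕ) (hx : ∀ s < n, x s ∈ A) :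
    info φ lam x (Finset.range n) ≤ 2 * maxInfoGain φ lam A n := by
  have h := le_ciSup (bddAbove_infoGain φ hlam hA n) fun i : Fin n => ⟨x i, hx i i.2⟩
  simp only at h
  rw [log_infoDet_eq_info] at h
  rw [maxInfoGain]
  linarith

/-- Playing the same arm `n` times is one way of gaining information. -/
theorem half_log_le_maxInfoGain (φ : E → H) {lam L κ : ℝ} (hlam : 0 < lam) (hκ : 0 < κ) {A : Set E}
    (hA : ∀ z ∈ A, ‖φ z‖ ≤ L) {a : E} (ha : a ∈ A) (hκa : κ ≤ ‖φ a‖) (n : ℕ) :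
    (1 / 2) * Real.log (1 + n * (κ ^ 2 / lam)) ≤ maxInfoGain φ lam A n := by
  have h := le_ciSup (bddAbove_infoGain φ hlam hA n) fun _ : Fin n => ⟨a, ha⟩
  refine le_trans ?_ h
  have hdet : infoDet φ lam (fun _ : Fin n => a) = 1 + n * (‖φ a‖ ^ 2 / lam) := by
    have : lam⁻¹ • kernelMatrix φ (fun _ : Fin n => a)
        = Matrix.replicateCol PUnit.{1} (fun _ : Fin n => lam⁻¹ * kernel φ a a)
          * Matrix.replicateRow PUnit.{1} fun _ : Fin n => (1 : ℝ) := by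
      ext i j
      simp [kernelMatrix, Matrix.mul_apply]
    rw [infoDet, this, Matrix.det_one_add_replicateCol_mul_replicateRow]
    simp only [dotProduct, kernel, one_mul, Finset.sum_const, Finset.card_univ, Fintype.card_fin,
      nsmul_eq_mul, real_inner_self_eq_norm_sq]
    ring
  simp only [hdet]
  gcongr

end InfoGain

/-! ### The synchronization protocol -/

section Protocol

variable {E H : Type*} [NormedAddCommGroup H] [InnerProductSpace ℝ H]

/-- The interactions in `[τ, t)` that are carried out by client `j`. -/
def localData (N τ t j : ℕ) : Finset ℕ := (Finset.Ico τ t).filter fun s => s % N = j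

/-- The data set of client `j` after `t` interactions, if the last synchronization took place after `τ`
interactions. -/
def clientData (N τ t j : ℕ) : Finset ℕ := Finset.range τ ∪ localData N τ t j

theorem mem_localData {N τ t j s : ℕ} :
    s ∈ localData N τ t j ↔ (τ ≤ s ∧ s < t) ∧ s % N = j := by
  rw [localData, Finset.mem_filter, Finset.mem_Ico]

theorem localData_succ {N τ t : ℕ} (h : τ ≤ t) (j : ℕ) :
    localData N τ (t + 1) j
      = if t % N = j then insert t (localData N τ t j) else localData N τ t j := by
  rw [localData, ← Finset.insert_Ico_right_eq_Ico_add_one h, Finset.filter_insert, localData]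

theorem localData_self (N τ j : ℕ) : localData N τ τ j = ∅ := by
  rw [localData, Finset.Ico_self, Finset.filter_empty]

theorem clientData_self (N τ j : ℕ) : clientData N τ τ j = Finset.range τ := by
  rw [clientData, localData_self, Finset.union_empty]

theorem clientData_succ {N τ t : ℕ} (h : τ ≤ t) (j : ℕ) :
    clientData N τ (t + 1) j
      = if t % N = j then insert t (clientData N τ t j) else clientData N τ t j := by
  rw [clientData, localData_succ h, clientData]
  split_ifs
  · rw [Finset.union_insert]
  · rfl

theorem disjoint_range_localData (N τ t j : ℕ) :
    Disjoint (Finset.range τ) (localData N τ t j) :=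
  Finset.disjoint_left.2 fun _ h1 h2 =>
    absurd (mem_localData.1 h2).1.1 (not_le.2 (Finset.mem_range.1 h1))

theorem clientData_subset_range {N τ t : ℕ} (h : τ ≤ t) (j : ℕ) :
    clientData N τ t j ⊆ Finset.range t :=
  Finset.union_subset (Finset.range_subset_range.2 h) fun _ hs =>
    Finset.mem_range.2 (mem_localData.1 hs).1.2

theorem range_subset_clientData (N τ t j : ℕ) : Finset.range τ ⊆ clientData N τ t j :=
  Finset.subset_union_left

theorem notMem_clientData {N τ t : ℕ} (h : τ ≤ t) (j : ℕ) : t ∉ clientData N τ t j := fun hs =>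
  lt_irrefl t (Finset.mem_range.1 (clientData_subset_range h j hs))

/-- A client carries out at most one interaction more than its share of an interval. -/
theorem card_localData_mul_le {N : ℕ} (hN : 1 ≤ N) {τ t : ℕ} (h : τ ≤ t) (i : ℕ) :
    N * ((localData N τ t (i % N)).card : ℝ) ≤ ((t : ℝ) - τ) + N := by
  have h1 : localData N τ t (i % N) = (Finset.Ico τ t).filter fun s => s ≡ i [MOD N] := rfl
  have h2 := Nat.Ico_filter_modEq_card τ t (show 0 < N from hN) i
  rw [← h1] at h2
  have hN' : (0 : ℚ) < N := by exact_mod_cast hN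
  have h3 : ((localData N τ t (i % N)).card : ℚ) ≤ ((t : ℚ) - τ) / N + 1 := by
    have h5 : (0 : ℚ) ≤ ((t : ℚ) - τ) / N :=
      div_nonneg (sub_nonneg.2 (by exact_mod_cast h)) hN'.le
    have h6 := Int.ceil_lt_add_one (((t : ℚ) - i) / N)
    have h7 := Int.le_ceil (((τ : ℚ) - i) / N)
    have h8 : ((t : ℚ) - i) / N - ((τ : ℚ) - i) / N = ((t : ℚ) - τ) / N := by ring
    have h4 : ((localData N τ t (i % N)).card : ℚ)
        = ((max (⌈((t : ℚ) - i) / N⌉ - ⌈((τ : ℚ) - i) / N⌉) 0 : ℤ) : ℚ) := by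
      exact_mod_cast h2
    rw [h4]
    push_cast
    refine max_le ?_ ?_ <;> linarith
  have h9 : N * ((localData N τ t (i % N)).card : ℚ) ≤ ((t : ℚ) - τ) + N := by
    calc N * ((localData N τ t (i % N)).card : ℚ) ≤ N * (((t : ℚ) - τ) / N + 1) :=
          mul_le_mul_of_nonneg_left h3 hN'.le
      _ = _ := by field_simp
  exact_mod_cast h9

/-- The synchronization event at interaction `t`, if the last synchronization took place after `τ`
interactions. -/
def TriggerAt (φ : E → H) (lam D : ℝ) (N : ℕ) (x : ℕ → E) (τ t : ℕ) : Prop :=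
  D < ((localData N τ (t + 1) (t % N)).card : ℝ)
    * (info φ lam x (clientData N τ (t + 1) (t % N)) - info φ lam x (Finset.range τ))

/-- Between synchronizations, the data sets and buffers are determined by `tLast`. -/
structure State.Synced (N t : ℕ) (st : State) : Prop where
  tLast_le : st.tLast ≤ t
  data_eq : ∀ j, st.data j = clientData N st.tLast t j
  buf_eq : ∀ j, st.buf j = localData N st.tLast t j

theorem State.Synced.observe {N t : ℕ} {st : State} (h : st.Synced N t) :
    (st.observe (t % N) t).Synced N (t + 1) where
  tLast_le := h.tLast_le.trans (Nat.le_succ t)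
  data_eq j := by
    have h' : st.tLast ≤ t := h.tLast_le
    change Function.update st.data (t % N) (insert t (st.data (t % N))) j
      = clientData N st.tLast (t + 1) j
    rw [clientData_succ h', Function.update_apply]
    by_cases hj : j = t % N
    · subst hj; simp [h.data_eq]
    · simp [hj, Ne.symm hj, h.data_eq]
  buf_eq j := by
    have h' : st.tLast ≤ t := h.tLast_le
    change Function.update st.buf (t % N) (insert t (st.buf (t % N))) j
      = localData N st.tLast (t + 1) j
    rw [localData_succ h', Function.update_apply]
    by_cases hj : j = t % N
    · subst hj; simp [h.buf_eq]
    · simp [hj, Ne.symm hj, h.buf_eq]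

theorem State.Synced.trigger_iff {φ : E → H} {lam D : ℝ} (hlam : 0 < lam) {N t : ℕ} {x : ℕ → E}
    {st : State} (h : st.Synced N (t + 1)) :
    st.Trigger φ lam D x (t % N) ↔ TriggerAt φ lam D N x st.tLast t := by
  have hcard : ((clientData N st.tLast (t + 1) (t % N)).card : ℝ) - st.tLast
      = (localData N st.tLast (t + 1) (t % N)).card := by
    rw [clientData, Finset.card_union_of_disjoint (disjoint_range_localData _ _ _ _),
      Finset.card_range]
    push_cast
    ring
  have hdiff : clientData N st.tLast (t + 1) (t % N) \ localData N st.tLast (t + 1) (t % N)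
      = Finset.range st.tLast := by
    rw [clientData, Finset.union_sdiff_right,
      Finset.sdiff_eq_self_of_disjoint (disjoint_range_localData _ _ _ _)]
  rw [State.Trigger, TriggerAt, h.data_eq, h.buf_eq, hcard, hdiff, log_dataDet_div φ hlam]

/-- A synchronization costs `N * (d + 1)` scalars for each interaction since the last one: every client
uploads or downloads every new data point. -/
theorem State.Synced.sync_cost {N t : ℕ} {st : State} (h : st.Synced N t) (d : ℕ) :
    (st.sync N d t).cost = st.cost + N * (t - st.tLast) * (d + 1) := by
  have h1 : ∀ j, (st.buf j).card + (Finset.range t \ st.data j).card = t - st.tLast := by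
    intro j
    rw [h.data_eq, h.buf_eq, Finset.card_sdiff_of_subset (clientData_subset_range h.tLast_le j),
      clientData, Finset.card_union_of_disjoint (disjoint_range_localData _ _ _ _),
      Finset.card_range, Finset.card_range]
    have : (clientData N st.tLast t j).card ≤ t := by
      simpa using Finset.card_le_card (clientData_subset_range (N := N) h.tLast_le j)
    rw [clientData, Finset.card_union_of_disjoint (disjoint_range_localData _ _ _ _),
      Finset.card_range] at this
    omega
  change st.cost + _ + _ = _
  rw [add_assoc, ← Finset.sum_add_distrib]
  simp only [← add_mul, h1, Finset.sum_const, Finset.card_range, smul_eq_mul, mul_assoc]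

theorem stateAt_synced (φ : E → H) (lam D : ℝ) (N d : ℕ) (x : ℕ → E) (t : ℕ) :
    (stateAt φ lam D N d x t).Synced N t := by
  induction t with
  | zero =>
    exact ⟨le_rfl, fun j => (clientData_self N 0 j).symm, fun j => (localData_self N 0 j).symm⟩
  | succ t ih =>
    rw [stateAt]
    split_ifs
    · exact ⟨le_rfl, fun j => (clientData_self N (t + 1) j).symm,
        fun j => (localData_self N (t + 1) j).symm⟩
    · exact ih.observe

/-- The number of interactions before the last synchronization, seen after `t` interactions. -/
def lastSync (φ : E → H) (lam D : ℝ) (N d : ℕ) (x : ℕ → E) (t : ℕ) : ℕ :=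
  (stateAt φ lam D N d x t).tLast

theorem lastSync_le (φ : E → H) (lam D : ℝ) (N d : ℕ) (x : ℕ → E) (t : ℕ) :
    lastSync φ lam D N d x t ≤ t := (stateAt_synced φ lam D N d x t).tLast_le

theorem stateAt_data (φ : E → H) (lam D : ℝ) (N d : ℕ) (x : ℕ → E) (t j : ℕ) :
    (stateAt φ lam D N d x t).data j = clientData N (lastSync φ lam D N d x t) t j :=
  (stateAt_synced φ lam D N d x t).data_eq j

theorem stateAt_succ_of_trigger (φ : E → H) {lam : ℝ} (hlam : 0 < lam) (D : ℝ)
    (N d : ℕ) (x : ℕ → E) (t : ℕ)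
    (h : TriggerAt φ lam D N x (lastSync φ lam D N d x t) t) :
    stateAt φ lam D N d x (t + 1)
      = ((stateAt φ lam D N d x t).observe (t % N) t).sync N d (t + 1) := by
  have h' := (State.Synced.trigger_iff (φ := φ) (D := D) (x := x) hlam
    (stateAt_synced φ lam D N d x t).observe).2 h
  rw [stateAt]
  exact if_pos h'

theorem stateAt_succ_of_not_trigger (φ : E → H) {lam : ℝ} (hlam : 0 < lam) (D : ℝ)
    (N d : ℕ) (x : ℕ → E) (t : ℕ)
    (h : ¬ TriggerAt φ lam D N x (lastSync φ lam D N d x t) t) :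
    stateAt φ lam D N d x (t + 1) = (stateAt φ lam D N d x t).observe (t % N) t := by
  have h' := mt (State.Synced.trigger_iff (φ := φ) (D := D) (x := x) hlam
    (stateAt_synced φ lam D N d x t).observe).1 h
  rw [stateAt]
  exact if_neg h'

theorem lastSync_succ_of_trigger (φ : E → H) {lam : ℝ} (hlam : 0 < lam) (D : ℝ)
    (N d : ℕ) (x : ℕ → E) (t : ℕ)
    (h : TriggerAt φ lam D N x (lastSync φ lam D N d x t) t) :
    lastSync φ lam D N d x (t + 1) = t + 1 := by
  rw [lastSync, stateAt_succ_of_trigger φ hlam D N d x t h]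
  rfl

theorem lastSync_succ_of_not_trigger (φ : E → H) {lam : ℝ} (hlam : 0 < lam) (D : ℝ)
    (N d : ℕ) (x : ℕ → E) (t : ℕ)
    (h : ¬ TriggerAt φ lam D N x (lastSync φ lam D N d x t) t) :
    lastSync φ lam D N d x (t + 1) = lastSync φ lam D N d x t := by
  rw [lastSync, stateAt_succ_of_not_trigger φ hlam D N d x t h]
  rfl

theorem lastSync_eq_of_le (φ : E → H) {lam : ℝ} (hlam : 0 < lam) (D : ℝ)
    (N d : ℕ) (x : ℕ → E) (t : ℕ)
    {s : ℕ} (h1 : lastSync φ lam D N d x t ≤ s) (h2 : s ≤ t) :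
    lastSync φ lam D N d x s = lastSync φ lam D N d x t := by
  induction t with
  | zero => rw [Nat.le_zero.1 h2]
  | succ t ih =>
    rcases Nat.lt_or_ge t s with hs | hs
    · rw [show s = t + 1 by omega]
    · by_cases h : TriggerAt φ lam D N x (lastSync φ lam D N d x t) t
      · rw [lastSync_succ_of_trigger φ hlam D N d x t h] at h1
        omega
      · rw [lastSync_succ_of_not_trigger φ hlam D N d x t h] at h1 ⊢
        exact ih h1 hs

theorem not_triggerAt_of_lastSync_le (φ : E → H) {lam : ℝ} (hlam : 0 < lam) (D : ℝ)
    (N d : ℕ) (x : ℕ → E) (t : ℕ)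
    {s : ℕ} (h1 : lastSync φ lam D N d x t ≤ s) (h2 : s < t) :
    ¬ TriggerAt φ lam D N x (lastSync φ lam D N d x t) s := by
  intro h
  rw [← lastSync_eq_of_le φ hlam D N d x t h1 h2.le] at h
  have h3 := lastSync_succ_of_trigger φ hlam D N d x s h
  rw [lastSync_eq_of_le φ hlam D N d x t (h1.trans (Nat.le_succ s)) h2] at h3
  omega

/-! ### Number of synchronizations and communication cost -/

theorem cost_le (φ : E → H) {lam : ℝ} (hlam : 0 < lam) (D : ℝ) (N d : ℕ) (x : ℕ → E) (t : ℕ) :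
    (stateAt φ lam D N d x t).cost ≤ N * lastSync φ lam D N d x t * (d + 1) := by
  induction t with
  | zero => simp [stateAt, State.init]
  | succ t ih =>
    by_cases h : TriggerAt φ lam D N x (lastSync φ lam D N d x t) t
    · rw [lastSync_succ_of_trigger φ hlam D N d x t h, stateAt_succ_of_trigger φ hlam D N d x t h,
        (stateAt_synced φ lam D N d x t).observe.sync_cost]
      have h1 := lastSync_le φ lam D N d x t
      change (stateAt φ lam D N d x t).cost + N * (t + 1 - lastSync φ lam D N d x t) * (d + 1) ≤ _
      calc _ ≤ N * lastSync φ lam D N d x t * (d + 1)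
            + N * (t + 1 - lastSync φ lam D N d x t) * (d + 1) := Nat.add_le_add_right ih _
        _ = N * (lastSync φ lam D N d x t + (t + 1 - lastSync φ lam D N d x t)) * (d + 1) := by ring
        _ = _ := by rw [Nat.add_sub_cancel' (h1.trans (Nat.le_succ t))]
    · rw [lastSync_succ_of_not_trigger φ hlam D N d x t h,
        stateAt_succ_of_not_trigger φ hlam D N d x t h]
      exact ih

/-- The induction step of the Cauchy–Schwarz inequality
`(∑ √(nₖ hₖ)) ^ 2 ≤ (∑ nₖ) (∑ hₖ)` for terms with `nₖ hₖ ≥ D`. -/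
theorem succ_sq_mul_le {B D a I n h : ℝ} (hD : 0 ≤ D) (ha : 0 ≤ a) (hI : 0 ≤ I)
    (hn : 0 ≤ n) (hh : 0 ≤ h) (h1 : B ^ 2 * D ≤ a * I) (h2 : D ≤ n * h) :
    (B + 1) ^ 2 * D ≤ (a + n) * (I + h) := by
  -- `(B D) ^ 2 ≤ (a h) (n I)`, and the arithmetic mean dominates the geometric mean
  have h3 : 2 * B * D ≤ a * h + n * I := by
    refine le_of_sq_le_sq ?_ (by positivity)
    have h4 : (B ^ 2 * D) * D ≤ (a * I) * (n * h) := mul_le_mul h1 h2 hD (by positivity)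
    nlinarith [sq_nonneg (a * h - n * I)]
  nlinarith

/-- Here `a` is the sum over all epochs of the number of interactions that the client which triggered the
synchronization carried out in the epoch. -/
theorem syncs_sq_mul_le (φ : E → H) {lam : ℝ} (hlam : 0 < lam) {D : ℝ} (hD : 0 ≤ D) {N : ℕ}
    (hN : 1 ≤ N) (d : ℕ) (x : ℕ → E) (t : ℕ) :
    ∃ a : ℝ, 0 ≤ a ∧ N * a ≤ lastSync φ lam D N d x t + N * (stateAt φ lam D N d x t).syncs ∧
      ((stateAt φ lam D N d x t).syncs : ℝ) ^ 2 * D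
        ≤ a * info φ lam x (Finset.range (lastSync φ lam D N d x t)) := by
  induction t with
  | zero => exact ⟨0, le_rfl, by simp only [mul_zero]; positivity, by simp [stateAt, State.init]⟩
  | succ t ih =>
    obtain ⟨a, ha, hNa, hB⟩ := ih
    set τ := lastSync φ lam D N d x t with hτ
    by_cases h : TriggerAt φ lam D N x τ t
    · have hτt : τ ≤ t + 1 := (lastSync_le φ lam D N d x t).trans (Nat.le_succ t)
      rw [lastSync_succ_of_trigger φ hlam D N d x t h, stateAt_succ_of_trigger φ hlam D N d x t h]
      have hs : ((((stateAt φ lam D N d x t).observe (t % N) t).sync N d (t + 1)).syncs : ℝ)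
          = (stateAt φ lam D N d x t).syncs + 1 := by
        change (((stateAt φ lam D N d x t).syncs + 1 : ℕ) : ℝ) = _
        push_cast
        rfl
      rw [hs]
      have hc := card_localData_mul_le hN hτt t
      refine ⟨a + (localData N τ (t + 1) (t % N)).card, by positivity, ?_, ?_⟩
      · push_cast at hc ⊢
        linarith
      · have h1 := info_mono φ hlam x (range_subset_clientData N τ (t + 1) (t % N))
        have h2 := info_mono φ hlam x (clientData_subset_range (N := N) hτt (t % N))
        have h3 := info_nonneg φ hlam x (Finset.range τ)
        have h4 : D ≤ ((localData N τ (t + 1) (t % N)).card : ℝ)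
            * (info φ lam x (Finset.range (t + 1)) - info φ lam x (Finset.range τ)) :=
          h.le.trans (mul_le_mul_of_nonneg_left (by linarith) (by positivity))
        have h5 := succ_sq_mul_le hD ha h3 (Nat.cast_nonneg _)
          (show (0 : ℝ) ≤ info φ lam x (Finset.range (t + 1)) - info φ lam x (Finset.range τ) by
            linarith) hB h4
        rwa [add_sub_cancel] at h5
    · rw [lastSync_succ_of_not_trigger φ hlam D N d x t h,
        stateAt_succ_of_not_trigger φ hlam D N d x t h]
      exact ⟨a, ha, hNa, hB⟩

/-- The number of synchronizations `B` satisfies `B ^ 2 D ≤ 2 γ (T + B)` with `D = T / (N γ)`; the bound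
solves this quadratic inequality. -/
theorem syncs_le (φ : E → H) {lam L : ℝ} (hlam : 0 < lam) {N T : ℕ}
    (hN : 1 ≤ N) (hT : 1 ≤ T) (d : ℕ) (x : ℕ → E) {A : Set E}
    (hA : ∀ z ∈ A, ‖φ z‖ ≤ L) (hx : ∀ s < N * T, x s ∈ A) {γ : ℝ}
    (hγ : γ = maxInfoGain φ lam A (N * T)) (hγ0 : 0 < γ) :
    ((stateAt φ lam (T / (N * γ)) N d x (N * T)).syncs : ℝ)
      ≤ 2 * (Real.sqrt N * γ + N * γ ^ 2 / T) := by
  have hN0 : (0 : ℝ) < N := by exact_mod_cast hN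
  have hT0 : (0 : ℝ) < T := by exact_mod_cast hT
  obtain ⟨a, ha, hNa, hB⟩ :=
    syncs_sq_mul_le φ hlam (show (0 : ℝ) ≤ T / (N * γ) by positivity) hN d x (N * T)
  set B : ℝ := ((stateAt φ lam (T / (N * γ)) N d x (N * T)).syncs : ℝ) with hB_def
  have hB0 : 0 ≤ B := Nat.cast_nonneg _
  have hτ := lastSync_le φ lam (T / (N * γ)) N d x (N * T)
  set τ := lastSync φ lam (T / (N * γ)) N d x (N * T)
  have hI : info φ lam x (Finset.range τ) ≤ 2 * γ :=
    (info_mono φ hlam x (Finset.range_subset_range.2 hτ)).trans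
      (hγ ▸ info_le_two_mul_maxInfoGain φ hlam hA x (N * T) hx)
  have ha2 : a ≤ T + B := by
    have : (τ : ℝ) ≤ N * T := by exact_mod_cast hτ
    have : N * a ≤ N * (T + B) := by linarith
    exact le_of_mul_le_mul_left this hN0
  have h1 : B ^ 2 * (T / (N * γ)) ≤ (T + B) * (2 * γ) :=
    hB.trans (mul_le_mul ha2 hI (info_nonneg φ hlam x _) (by positivity))
  have h2 : B ^ 2 ≤ 2 * (Real.sqrt N * γ) ^ 2 + 2 * (N * γ ^ 2 / T) * B := by
    have h3 : B ^ 2 = B ^ 2 * (T / (N * γ)) * (N * γ / T) := by field_simp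
    rw [h3]
    calc B ^ 2 * (T / (N * γ)) * (N * γ / T) ≤ (T + B) * (2 * γ) * (N * γ / T) :=
          mul_le_mul_of_nonneg_right h1 (by positivity)
      _ = 2 * (N * γ ^ 2) + 2 * (N * γ ^ 2 / T) * B := by field_simp
      _ = _ := by rw [mul_pow, Real.sq_sqrt hN0.le]
  have hu : 0 < Real.sqrt N * γ := by positivity
  have hv : 0 < N * γ ^ 2 / T := by positivity
  by_contra hlt
  rw [not_le] at hlt
  nlinarith [mul_lt_mul_of_pos_left hlt hu, mul_lt_mul_of_pos_left hlt hv]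

end Protocol

/-! ### Sums of confidence widths over the epochs -/

section Widths

variable {E H : Type*} [NormedAddCommGroup H] [InnerProductSpace ℝ H]

theorem sum_postVar_range_le (φ : E → H) {lam L : ℝ} (hlam : 0 < lam) (x : ℕ → E) {τ m : ℕ}
    (hτ : τ ≤ m) (hx : ∀ s < m, ‖φ (x s)‖ ≤ L) :
    ∑ s ∈ Finset.Ico τ m, postVar φ lam x (Finset.range s) (x s)
      ≤ (1 + L ^ 2 / lam) * (info φ lam x (Finset.range m) - info φ lam x (Finset.range τ)) := by
  induction m, hτ using Nat.le_induction with
  | base => simp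
  | succ m hm ih =>
    have h1 := ih fun s hs => hx s (hs.trans (Nat.lt_succ_self m))
    have h2 := postVar_le_mul_log φ hlam x (Finset.range m) (hx m (Nat.lt_succ_self m))
    rw [Finset.sum_Ico_succ_top hm, Finset.range_add_one,
      info_insert φ hlam x Finset.notMem_range_self]
    linarith

theorem sum_postVar_localData_le (φ : E → H) {lam L : ℝ} (hlam : 0 < lam) (N : ℕ) (x : ℕ → E)
    {τ m : ℕ} (hτ : τ ≤ m) (hx : ∀ s < m, ‖φ (x s)‖ ≤ L) (j : ℕ) :
    ∑ s ∈ localData N τ m j, postVar φ lam x (clientData N τ s j) (x s)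
      ≤ (1 + L ^ 2 / lam)
        * (info φ lam x (clientData N τ m j) - info φ lam x (Finset.range τ)) := by
  induction m, hτ using Nat.le_induction with
  | base => simp [localData_self, clientData_self]
  | succ m hm ih =>
    have h1 := ih fun s hs => hx s (hs.trans (Nat.lt_succ_self m))
    rw [localData_succ hm, clientData_succ hm]
    split_ifs
    · have h2 := postVar_le_mul_log φ hlam x (clientData N τ m j) (hx m (Nat.lt_succ_self m))
      rw [Finset.sum_insert fun h => lt_irrefl m (mem_localData.1 h).1.2,
        info_insert φ hlam x (notMem_clientData hm j)]
      linarith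
    · exact h1

/-- As long as no synchronization is triggered, the confidence widths of a client add up to at most
`√((1 + L ^ 2 / lam) D)`. -/
theorem sum_sigmaHat_localData_le (φ : E → H) {lam L D : ℝ} (hlam : 0 < lam) (hD : 0 ≤ D)
    (N : ℕ) (x : ℕ → E) {τ m : ℕ} (hτ : τ ≤ m) (hx : ∀ s < m, ‖φ (x s)‖ ≤ L)
    (htr : ∀ s, τ ≤ s → s < m → ¬ TriggerAt φ lam D N x τ s) (j : ℕ) :
    ∑ s ∈ localData N τ m j, sigmaHat φ lam x (clientData N τ s j) (x s)
      ≤ Real.sqrt ((1 + L ^ 2 / lam) * D) := by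
  have hcard : ((localData N τ m j).card : ℝ)
      * (info φ lam x (clientData N τ m j) - info φ lam x (Finset.range τ)) ≤ D := by
    clear hx
    induction m, hτ using Nat.le_induction with
    | base => simpa [localData_self] using hD
    | succ m hm ih =>
      by_cases hj : m % N = j
      · have h := htr m hm (Nat.lt_succ_self m)
        rw [TriggerAt, hj, not_lt] at h
        exact h
      · rw [localData_succ hm, clientData_succ hm, if_neg hj, if_neg hj]
        exact ih fun s h1 h2 => htr s h1 (h2.trans (Nat.lt_succ_self m))
  apply Real.le_sqrt_of_sq_le
  calc (∑ s ∈ localData N τ m j, sigmaHat φ lam x (clientData N τ s j) (x s)) ^ 2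
      ≤ (localData N τ m j).card
        * ∑ s ∈ localData N τ m j, sigmaHat φ lam x (clientData N τ s j) (x s) ^ 2 :=
        sq_sum_le_card_mul_sum_sq
    _ ≤ (localData N τ m j).card * ((1 + L ^ 2 / lam)
        * (info φ lam x (clientData N τ m j) - info φ lam x (Finset.range τ))) := by
        simp only [sigmaHat_sq φ hlam]
        exact mul_le_mul_of_nonneg_left (sum_postVar_localData_le φ hlam N x hτ hx j)
          (Nat.cast_nonneg _)
    _ = (1 + L ^ 2 / lam) * ((localData N τ m j).card
        * (info φ lam x (clientData N τ m j) - info φ lam x (Finset.range τ))) := by ring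
    _ ≤ _ := mul_le_mul_of_nonneg_left hcard (by positivity)

theorem sigmaHat_le (φ : E → H) {lam L : ℝ} (hlam : 0 < lam) (hL : 0 ≤ L) (x : ℕ → E)
    (S : Finset ℕ) {z : E} (hz : ‖φ z‖ ≤ L) : sigmaHat φ lam x S z ≤ L / Real.sqrt lam := by
  rw [sigmaHat_eq_sqrt φ hlam]
  refine Real.sqrt_le_iff.2 ⟨by positivity, (postVar_le φ hlam x S z).trans ?_⟩
  rw [div_pow, Real.sq_sqrt hlam.le]
  gcongr

/-- The largest possible sum of the confidence widths in an epoch: a synchronization is triggered by at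
most one interaction of the epoch. -/
def epochWidth (lam L D : ℝ) (N : ℕ) : ℝ :=
  N * Real.sqrt ((1 + L ^ 2 / lam) * D) + L / Real.sqrt lam

theorem sum_sigmaHat_epoch_le (φ : E → H) {lam L D : ℝ} (hlam : 0 < lam) (hL : 0 ≤ L) (hD : 0 ≤ D)
    {N : ℕ} (hN : 1 ≤ N) (x : ℕ → E) {τ m : ℕ} (hτ : τ ≤ m) (hx : ∀ s < m, ‖φ (x s)‖ ≤ L)
    (htr : ∀ s, τ ≤ s → s + 1 < m → ¬ TriggerAt φ lam D N x τ s) :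
    ∑ s ∈ Finset.Ico τ m, sigmaHat φ lam x (clientData N τ s (s % N)) (x s)
      ≤ epochWidth lam L D N := by
  -- without the last interaction, no client has triggered a synchronization
  have key : ∀ m, τ ≤ m → (∀ s < m, ‖φ (x s)‖ ≤ L) →
      (∀ s, τ ≤ s → s < m → ¬ TriggerAt φ lam D N x τ s) →
      ∑ s ∈ Finset.Ico τ m, sigmaHat φ lam x (clientData N τ s (s % N)) (x s)
        ≤ N * Real.sqrt ((1 + L ^ 2 / lam) * D) := by
    intro m hτ hx htr
    rw [← Finset.sum_fiberwise_of_maps_to (t := Finset.range N) (g := fun s => s % N)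
      fun s _ => Finset.mem_range.2 (Nat.mod_lt s hN)]
    calc _ ≤ ∑ j ∈ Finset.range N, Real.sqrt ((1 + L ^ 2 / lam) * D) := by
          refine Finset.sum_le_sum fun j _ => ?_
          refine le_of_eq_of_le ?_ (sum_sigmaHat_localData_le φ hlam hD N x hτ hx htr j)
          refine Finset.sum_congr rfl fun s hs => ?_
          rw [(Finset.mem_filter.1 hs).2]
      _ = _ := by simp
  have h0 : 0 ≤ L / Real.sqrt lam := by positivity
  rcases hτ.eq_or_lt with rfl | hlt
  · simp only [Finset.Ico_self, Finset.sum_empty, epochWidth]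
    positivity
  · obtain ⟨m, rfl⟩ : ∃ k, m = k + 1 := ⟨m - 1, by omega⟩
    have hm : τ ≤ m := Nat.lt_succ_iff.1 hlt
    rw [Finset.sum_Ico_succ_top hm, epochWidth]
    exact add_le_add
      (key m hm (fun s hs => hx s (hs.trans (Nat.lt_succ_self m)))
        fun s h1 h2 => htr s h1 (Nat.succ_lt_succ h2))
      (sigmaHat_le φ hlam hL x _ (hx m (Nat.lt_succ_self m)))

/-- The confidence width of the arm of interaction `s` in the estimate of the client that plays it. -/
def playedWidth (φ : E → H) (lam D : ℝ) (N d : ℕ) (x : ℕ → E) (s : ℕ) : ℝ :=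
  sigmaHat φ lam x (clientData N (lastSync φ lam D N d x s) s (s % N)) (x s)

/-- The first `m` interactions split into those of good epochs, in which the information grows by at
most `1`, and those of `b` bad epochs. -/
def WidthSplit (φ : E → H) (lam L D : ℝ) (N d : ℕ) (x : ℕ → E) (m : ℕ) : Prop :=
  ∃ (G : Finset ℕ) (b : ℕ), G ⊆ Finset.range m ∧ (b : ℝ) ≤ info φ lam x (Finset.range m) ∧
    ∑ s ∈ G, playedWidth φ lam D N d x s ^ 2
      ≤ Real.exp 1 * ((1 + L ^ 2 / lam) * info φ lam x (Finset.range m)) ∧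
    ∑ s ∈ Finset.range m \ G, playedWidth φ lam D N d x s ≤ b * epochWidth lam L D N

/-- An epoch in which the information grows by at most `1` joins the good epochs, since its widths are at
most `√e` times those computed from all previous data; any other epoch joins the bad ones. -/
theorem widthSplit_epoch (φ : E → H) {lam L D : ℝ} (hlam : 0 < lam) (hL : 0 ≤ L) (hD : 0 ≤ D)
    {N : ℕ} (hN : 1 ≤ N) (d : ℕ) (x : ℕ → E) {τ m : ℕ} (hτ : τ ≤ m)
    (hx : ∀ s < m, ‖φ (x s)‖ ≤ L)
    (hsync : ∀ s, τ ≤ s → s < m → lastSync φ lam D N d x s = τ)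
    (htr : ∀ s, τ ≤ s → s + 1 < m → ¬ TriggerAt φ lam D N x τ s)
    (h : WidthSplit φ lam L D N d x τ) : WidthSplit φ lam L D N d x m := by
  obtain ⟨G, b, hG, hb, hgood, hbad⟩ := h
  have hwidth : ∀ s ∈ Finset.Ico τ m, playedWidth φ lam D N d x s
      = sigmaHat φ lam x (clientData N τ s (s % N)) (x s) := fun s hs => by
    rw [playedWidth, hsync s (Finset.mem_Ico.1 hs).1 (Finset.mem_Ico.1 hs).2]
  have hmono := info_mono φ hlam x (Finset.range_subset_range.2 hτ)
  have hdisj : Disjoint (Finset.range τ) (Finset.Ico τ m) :=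
    Finset.disjoint_left.2 fun s h1 h2 =>
      absurd (Finset.mem_Ico.1 h2).1 (not_le.2 (Finset.mem_range.1 h1))
  have hunion : Finset.range m = Finset.range τ ∪ Finset.Ico τ m := by
    ext s
    simp only [Finset.mem_union, Finset.mem_range, Finset.mem_Ico]
    omega
  have hdisjG : Disjoint G (Finset.Ico τ m) := Finset.disjoint_of_subset_left hG hdisj
  by_cases hinc : info φ lam x (Finset.range m) - info φ lam x (Finset.range τ) ≤ 1
  · refine ⟨G ∪ Finset.Ico τ m, b, ?_, hb.trans hmono, ?_, ?_⟩
    · rw [hunion]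
      exact Finset.union_subset_union_left hG
    · rw [Finset.sum_union hdisjG]
      have h1 : ∑ s ∈ Finset.Ico τ m, playedWidth φ lam D N d x s ^ 2
          ≤ Real.exp 1 * ∑ s ∈ Finset.Ico τ m, postVar φ lam x (Finset.range s) (x s) := by
        rw [Finset.mul_sum]
        refine Finset.sum_le_sum fun s hs => ?_
        have hs' := Finset.mem_Ico.1 hs
        rw [hwidth s hs, sigmaHat_sq φ hlam]
        refine (postVar_le_exp_mul φ hlam x (clientData_subset_range hs'.1 (s % N)) _).trans ?_
        refine mul_le_mul_of_nonneg_right (Real.exp_le_exp.2 ?_) (postVar_nonneg φ hlam x _ _)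
        have h2 := info_mono φ hlam x (Finset.range_subset_range.2 hs'.2.le)
        have h3 := info_mono φ hlam x (range_subset_clientData N τ s (s % N))
        linarith
      have h4 := mul_le_mul_of_nonneg_left (sum_postVar_range_le φ hlam x hτ hx)
        (Real.exp_nonneg 1)
      linarith
    · refine le_of_eq_of_le ?_ hbad
      congr 1
      rw [hunion]
      ext s
      have h1 : s ∈ Finset.range τ → s ∉ Finset.Ico τ m := fun h => Finset.disjoint_left.1 hdisj h
      simp only [Finset.mem_sdiff, Finset.mem_union]
      tauto
  · rw [not_le] at hinc
    refine ⟨G, b + 1, ?_, ?_, ?_, ?_⟩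
    · exact hG.trans (Finset.range_subset_range.2 hτ)
    · push_cast
      linarith
    · exact hgood.trans (by gcongr)
    · rw [hunion, Finset.union_sdiff_distrib, Finset.sdiff_eq_self_of_disjoint hdisjG.symm,
        Finset.sum_union (Finset.disjoint_of_subset_left Finset.sdiff_subset hdisj),
        Finset.sum_congr rfl hwidth]
      have := sum_sigmaHat_epoch_le φ hlam hL hD hN x hτ hx htr
      push_cast
      linarith

theorem widthSplit_lastSync (φ : E → H) {lam L D : ℝ} (hlam : 0 < lam) (hL : 0 ≤ L) (hD : 0 ≤ D)
    {N : ℕ} (hN : 1 ≤ N) (d : ℕ) (x : ℕ → E) (t : ℕ) (hx : ∀ s < t, ‖φ (x s)‖ ≤ L) :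
    WidthSplit φ lam L D N d x (lastSync φ lam D N d x t) := by
  induction t with
  | zero =>
    change WidthSplit φ lam L D N d x 0
    exact ⟨∅, 0, by simp, by simp [info_empty], by simp [info_empty], by simp⟩
  | succ t ih =>
    have ih' := ih fun s hs => hx s (hs.trans (Nat.lt_succ_self t))
    by_cases h : TriggerAt φ lam D N x (lastSync φ lam D N d x t) t
    · rw [lastSync_succ_of_trigger φ hlam D N d x t h]
      refine widthSplit_epoch φ hlam hL hD hN d x
        ((lastSync_le φ lam D N d x t).trans (Nat.le_succ t)) hx ?_ ?_ ih'
      · exact fun s h1 h2 => lastSync_eq_of_le φ hlam D N d x t h1 (Nat.lt_succ_iff.1 h2)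
      · exact fun s h1 h2 => not_triggerAt_of_lastSync_le φ hlam D N d x t h1
          (Nat.succ_lt_succ_iff.1 h2)
    · rwa [lastSync_succ_of_not_trigger φ hlam D N d x t h]

/-- The sum of all confidence widths: Cauchy–Schwarz over the good epochs, and `epochWidth` for each
bad epoch. -/
theorem sum_playedWidth_le (φ : E → H) {lam L D γ : ℝ} (hlam : 0 < lam) (hL : 0 ≤ L) (hD : 0 ≤ D)
    {N : ℕ} (hN : 1 ≤ N) (d : ℕ) (x : ℕ → E) (n : ℕ) (hx : ∀ s < n, ‖φ (x s)‖ ≤ L)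
    (hγ : info φ lam x (Finset.range n) ≤ 2 * γ) :
    ∑ s ∈ Finset.range n, playedWidth φ lam D N d x s
      ≤ Real.sqrt (n * (Real.exp 1 * ((1 + L ^ 2 / lam) * (2 * γ))))
        + 2 * γ * epochWidth lam L D N := by
  have h : WidthSplit φ lam L D N d x n := by
    refine widthSplit_epoch φ hlam hL hD hN d x (lastSync_le φ lam D N d x n) hx ?_ ?_
      (widthSplit_lastSync φ hlam hL hD hN d x n hx)
    · exact fun s h1 h2 => lastSync_eq_of_le φ hlam D N d x n h1 h2.le
    · exact fun s h1 h2 => not_triggerAt_of_lastSync_le φ hlam D N d x n h1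
        ((Nat.lt_succ_self s).trans h2)
  obtain ⟨G, b, hG, hb, hgood, hbad⟩ := h
  rw [← Finset.sum_sdiff hG, add_comm]
  refine add_le_add ?_ (hbad.trans (mul_le_mul_of_nonneg_right (hb.trans hγ) ?_))
  · apply Real.le_sqrt_of_sq_le
    have hcard : (G.card : ℝ) ≤ n := by
      exact_mod_cast (Finset.card_le_card hG).trans (Finset.card_range n).le
    calc (∑ s ∈ G, playedWidth φ lam D N d x s) ^ 2
        ≤ G.card * ∑ s ∈ G, playedWidth φ lam D N d x s ^ 2 := sq_sum_le_card_mul_sum_sq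
      _ ≤ n * (Real.exp 1 * ((1 + L ^ 2 / lam) * (2 * γ))) := by
        refine mul_le_mul hcard (hgood.trans ?_) (Finset.sum_nonneg fun s _ => sq_nonneg _)
          (Nat.cast_nonneg _)
        gcongr
  · rw [epochWidth]
    positivity

end Widths

/-! ### Regret on the event that all confidence intervals are valid -/

section Regret

variable {E H : Type*} [NormedAddCommGroup H] [InnerProductSpace ℝ H]

/-- The squared norm of the noise is at most the squared noise part of `alpha`. -/
def NoiseBounded (φ : E → H) (lam R δ : ℝ) (N : ℕ) (x : ℕ → E) (η : ℕ → ℝ) (S : Finset ℕ) : Prop :=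
  noiseForm φ lam x η S ≤ R ^ 2 * (4 * Real.log (N / δ) + 2 * info φ lam x S)

theorem abs_muHat_sub_le_alpha (φ : E → H) {lam R : ℝ} (hlam : 0 < lam) (hR : 0 < R) (δ : ℝ)
    (N : ℕ) (θ : H) (x : ℕ → E) (y η : ℕ → ℝ) (S : Finset ℕ)
    (hy : ∀ s ∈ S, y s = inner ℝ θ (φ (x s)) + η s)
    (h : NoiseBounded φ lam R δ N x η S) (z : E) :
    |muHat φ lam x y S z - inner ℝ θ (φ z)|
      ≤ alpha φ θ lam R δ N x S * sigmaHat φ lam x S z := by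
  refine (abs_muHat_sub_le φ hlam θ x y η S hy z).trans
    (mul_le_mul_of_nonneg_right ?_ (sigmaHat_nonneg φ lam x S z))
  rw [alpha]
  gcongr
  have h1 := Real.sqrt_le_sqrt h
  rwa [Real.sqrt_mul (sq_nonneg R), Real.sqrt_sq hR.le] at h1

/-- The optimism argument: a maximizer of the upper confidence bound has regret at most twice its
confidence width. -/
theorem sSup_sub_le (φ : E → H) {lam R : ℝ} (hlam : 0 < lam) (hR : 0 < R) (δ : ℝ)
    (N : ℕ) (θ : H) (x : ℕ → E) (y η : ℕ → ℝ) (S : Finset ℕ)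
    (hy : ∀ s ∈ S, y s = inner ℝ θ (φ (x s)) + η s)
    (h : NoiseBounded φ lam R δ N x η S) {cand : Set E} {a : E} (ha : a ∈ cand)
    (hmax : IsMaxOn (ucb φ θ lam R δ N x y S) cand a) :
    sSup ((fun z => inner ℝ θ (φ z)) '' cand) - inner ℝ θ (φ a)
      ≤ 2 * alpha φ θ lam R δ N x S * sigmaHat φ lam x S a := by
  have hcov := abs_muHat_sub_le_alpha φ hlam hR δ N θ x y η S hy h
  have h1 : sSup ((fun z => inner ℝ θ (φ z)) '' cand) ≤ ucb φ θ lam R δ N x y S a := by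
    refine csSup_le ⟨_, a, ha, rfl⟩ ?_
    rintro _ ⟨z, hz, rfl⟩
    refine le_trans ?_ (hmax hz)
    have := (abs_le.1 (hcov z)).1
    simp only [ucb]
    linarith
  have h2 := (abs_le.1 (hcov a)).2
  rw [ucb] at h1
  linarith

theorem regret_le_sum_playedWidth (φ : E → H) {lam R D δ γ : ℝ} (hlam : 0 < lam) (hR : 0 < R)
    {N d : ℕ} (θ : H) (x : ℕ → E) (y η : ℕ → ℝ) (cand : ℕ → Set E) (n : ℕ)
    (hγ : info φ lam x (Finset.range n) ≤ 2 * γ)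
    (hy : ∀ s < n, y s = inner ℝ θ (φ (x s)) + η s)
    (hcand : ∀ s < n, x s ∈ cand s ∧ IsMaxOn (ucb φ θ lam R δ N x y
      (clientData N (lastSync φ lam D N d x s) s (s % N))) (cand s) (x s))
    (h : ∀ s < n, NoiseBounded φ lam R δ N x η
      (clientData N (lastSync φ lam D N d x s) s (s % N))) :
    regret φ θ cand x n
      ≤ 2 * (Real.sqrt lam * ‖θ‖ + R * Real.sqrt (4 * Real.log (N / δ) + 4 * γ))
        * ∑ s ∈ Finset.range n, playedWidth φ lam D N d x s := by
  rw [regret, Finset.mul_sum]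
  refine Finset.sum_le_sum fun s hs => ?_
  have hs' := Finset.mem_range.1 hs
  have hsub : clientData N (lastSync φ lam D N d x s) s (s % N) ⊆ Finset.range s :=
    clientData_subset_range (lastSync_le φ lam D N d x s) _
  refine (sSup_sub_le φ hlam hR δ N θ x y η _
    (fun r hr => hy r ((Finset.mem_range.1 (hsub hr)).trans hs')) (h s hs')
    (hcand s hs').1 (hcand s hs').2).trans ?_
  refine mul_le_mul_of_nonneg_right ?_ (sigmaHat_nonneg φ lam x _ _)
  have h1 := info_mono φ hlam x (hsub.trans (Finset.range_subset_range.2 hs'.le))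
  have h2 : 4 * Real.log (N / δ) + 2 * Real.log (dataDet φ lam x
      (clientData N (lastSync φ lam D N d x s) s (s % N))) ≤ 4 * Real.log (N / δ) + 4 * γ := by
    change 4 * Real.log (N / δ) + 2 * info φ lam x _ ≤ _
    linarith
  rw [alpha]
  gcongr 2 * (_ + R * ?_)
  exact Real.sqrt_le_sqrt h2

/-- The information gained by repeating one arm makes `log (N / δ)` at most a constant multiple of `γ`:
by Bernoulli's inequality `log (1 + N ρ)` bounds a multiple of `log N`, and it is at least the constant
`log (1 + ρ)`. -/
theorem log_div_le_mul {lam κ δ γ : ℝ} (hlam : 0 < lam) (hκ : 0 < κ) (hδ : 0 < δ) (hδ1 : δ < 1)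
    {N T : ℕ} (hN : 1 ≤ N) (hT : 1 ≤ T)
    (hγ : (1 / 2) * Real.log (1 + (N * T : ℕ) * (κ ^ 2 / lam)) ≤ γ) :
    Real.log (N / δ) ≤ (2 / min 1 (κ ^ 2 / lam)
      + 2 * Real.log (1 / δ) / Real.log (1 + κ ^ 2 / lam)) * γ := by
  set ρ := κ ^ 2 / lam with hρ_def
  have hρ : 0 < ρ := by positivity
  have hN0 : (1 : ℝ) ≤ N := by exact_mod_cast hN
  have hNT : (N : ℝ) ≤ (N * T : ℕ) := by exact_mod_cast Nat.le_mul_of_pos_right N hT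
  have hm : 0 < min 1 ρ := lt_min one_pos hρ
  have h1 : Real.log (1 + N * ρ) ≤ 2 * γ := by
    have : Real.log (1 + N * ρ) ≤ Real.log (1 + (N * T : ℕ) * ρ) := by gcongr
    linarith
  have h2 : min 1 ρ * Real.log N ≤ 2 * γ := by
    refine le_trans ?_ h1
    have h3 : (1 + (N : ℝ)) ^ (min 1 ρ) ≤ 1 + min 1 ρ * N :=
      rpow_one_add_le_one_add_mul_self (by linarith) hm.le (min_le_left _ _)
    calc min 1 ρ * Real.log N ≤ min 1 ρ * Real.log (1 + N) := by gcongr; linarith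
      _ = Real.log ((1 + (N : ℝ)) ^ (min 1 ρ)) := (Real.log_rpow (by positivity) _).symm
      _ ≤ Real.log (1 + min 1 ρ * N) := Real.log_le_log (by positivity) h3
      _ ≤ Real.log (1 + N * ρ) := by
        refine Real.log_le_log (by positivity) ?_
        nlinarith [min_le_right 1 ρ]
  have h4 : 0 < Real.log (1 + ρ) := Real.log_pos (by linarith)
  have h5 : Real.log (1 + ρ) ≤ 2 * γ := by
    refine le_trans (Real.log_le_log (by positivity) ?_) h1
    nlinarith
  have h6 : 0 ≤ Real.log (1 / δ) := Real.log_nonneg (by rw [le_div_iff₀ hδ]; linarith)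
  have h7 : Real.log (N / δ) = Real.log N + Real.log (1 / δ) := by
    rw [div_eq_mul_one_div, Real.log_mul (by positivity) (by positivity)]
  rw [h7, add_mul]
  refine add_le_add ?_ ?_
  · rw [div_mul_eq_mul_div, le_div_iff₀ hm]
    linarith
  · rw [div_mul_eq_mul_div, le_div_iff₀ h4]
    nlinarith

/-- The constant of the regret bound: twice the factor of `alpha_bound`, which bounds the exploration
coefficient, times the factor of `width_bound`, which bounds the sum of the confidence widths. -/
def regretConst (lam R L κ δ : ℝ) : ℝ :=
  2 * (Real.sqrt lam + R * Real.sqrt (4 * (2 / min 1 (κ ^ 2 / lam)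
      + 2 * Real.log (1 / δ) / Real.log (1 + κ ^ 2 / lam)) + 4))
    * (Real.sqrt (Real.exp 1 * ((1 + L ^ 2 / lam) * 2)) + 2 * Real.sqrt (1 + L ^ 2 / lam)
      + 2 * (L / Real.sqrt lam) ^ 2)

theorem regretConst_pos {lam R L : ℝ} (hlam : 0 < lam) (hR : 0 < R) (hL : 0 < L) (κ δ : ℝ) :
    0 < regretConst lam R L κ δ := by
  have h1 : 0 < Real.sqrt lam := Real.sqrt_pos.2 hlam
  have h2 : 0 < L / Real.sqrt lam := div_pos hL h1
  rw [regretConst]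
  positivity

/-- The bound of `sum_playedWidth_le` for the threshold `D = T / (N γ)`: this choice gives the bad epochs a
total width of order `√(N T γ)`, the order of the good ones. -/
theorem width_bound {lam L γ : ℝ} (hlam : 0 < lam) (hL : 0 < L) {N T : ℕ} (hN : 1 ≤ N) (hT : 1 ≤ T)
    (hγ0 : 0 < γ) (hγ : γ ≤ (1 / 2) * ((N * T : ℕ) * (L ^ 2 / lam))) :
    Real.sqrt ((N * T : ℕ) * (Real.exp 1 * ((1 + L ^ 2 / lam) * (2 * γ))))
        + 2 * γ * epochWidth lam L (T / (N * γ)) N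
      ≤ (Real.sqrt (Real.exp 1 * ((1 + L ^ 2 / lam) * 2)) + 2 * Real.sqrt (1 + L ^ 2 / lam)
        + 2 * (L / Real.sqrt lam) ^ 2) * (Real.sqrt (N * T) * Real.sqrt γ) := by
  have hN0 : (0 : ℝ) < N := by exact_mod_cast hN
  have hT0 : (0 : ℝ) < T := by exact_mod_cast hT
  rw [← Real.sqrt_mul (by positivity), epochWidth]
  push_cast at hγ ⊢
  have h1 : Real.sqrt (N * T * (Real.exp 1 * ((1 + L ^ 2 / lam) * (2 * γ))))
      = Real.sqrt (Real.exp 1 * ((1 + L ^ 2 / lam) * 2)) * Real.sqrt (N * T * γ) := by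
    rw [← Real.sqrt_mul (by positivity)]
    congr 1
    ring
  have h2 : γ * (N * Real.sqrt ((1 + L ^ 2 / lam) * (T / (N * γ))))
      = Real.sqrt (1 + L ^ 2 / lam) * Real.sqrt (N * T * γ) := by
    rw [← Real.sqrt_mul (by positivity), ← mul_assoc]
    nth_rewrite 1 [← Real.sqrt_sq (show 0 ≤ γ * N by positivity)]
    rw [← Real.sqrt_mul (by positivity)]
    congr 1
    field_simp
  have h3 : γ * (L / Real.sqrt lam) ≤ (L / Real.sqrt lam) ^ 2 * Real.sqrt (N * T * γ) := by
    have h4 : γ ≤ L / Real.sqrt lam * Real.sqrt (N * T * γ) := by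
      refine le_of_sq_le_sq ?_ (by positivity)
      rw [mul_pow, div_pow, Real.sq_sqrt hlam.le, Real.sq_sqrt (by positivity)]
      have h5 : 0 ≤ N * T * (L ^ 2 / lam) := by positivity
      nlinarith
    have h6 : 0 ≤ L / Real.sqrt lam := by positivity
    calc γ * (L / Real.sqrt lam) ≤ L / Real.sqrt lam * Real.sqrt (N * T * γ) * (L / Real.sqrt lam) :=
          mul_le_mul_of_nonneg_right h4 h6
      _ = _ := by ring
  rw [h1]
  linarith

theorem alpha_bound {lam R κ δ γ ϑ : ℝ} (hlam : 0 < lam) (hR : 0 < R) (hκ : 0 < κ) (hδ : 0 < δ)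
    (hδ1 : δ < 1) {N T : ℕ} (hN : 1 ≤ N) (hT : 1 ≤ T) (hϑ : 0 ≤ ϑ)
    (hγ : (1 / 2) * Real.log (1 + (N * T : ℕ) * (κ ^ 2 / lam)) ≤ γ) :
    Real.sqrt lam * ϑ + R * Real.sqrt (4 * Real.log (N / δ) + 4 * γ)
      ≤ (Real.sqrt lam + R * Real.sqrt (4 * (2 / min 1 (κ ^ 2 / lam)
        + 2 * Real.log (1 / δ) / Real.log (1 + κ ^ 2 / lam)) + 4)) * (ϑ + Real.sqrt γ) := by
  have h := log_div_le_mul hlam hκ hδ hδ1 hN hT hγ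
  set K := 2 / min 1 (κ ^ 2 / lam) + 2 * Real.log (1 / δ) / Real.log (1 + κ ^ 2 / lam)
  have hK : 0 ≤ K := by
    have h1 : 0 ≤ Real.log (1 / δ) := Real.log_nonneg (by rw [le_div_iff₀ hδ]; linarith)
    have h2 : 0 < κ ^ 2 / lam := by positivity
    have h3 : 0 ≤ Real.log (1 + κ ^ 2 / lam) := Real.log_nonneg (by linarith)
    have h4 : 0 < min 1 (κ ^ 2 / lam) := lt_min one_pos h2
    positivity
  have h1 : Real.sqrt (4 * Real.log (N / δ) + 4 * γ) ≤ Real.sqrt (4 * K + 4) * Real.sqrt γ := by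
    rw [← Real.sqrt_mul (by positivity)]
    apply Real.sqrt_le_sqrt
    linarith
  have h2 : R * Real.sqrt (4 * Real.log (N / δ) + 4 * γ)
      ≤ R * (Real.sqrt (4 * K + 4) * Real.sqrt γ) := mul_le_mul_of_nonneg_left h1 hR.le
  have h3 : 0 ≤ Real.sqrt lam * Real.sqrt γ := by positivity
  have h4 : 0 ≤ R * Real.sqrt (4 * K + 4) * ϑ := by positivity
  linarith

theorem regret_le (φ : E → H) {lam R L κ δ γ : ℝ} (hlam : 0 < lam) (hR : 0 < R) (hL : 0 < L)
    (hκ : 0 < κ) (hδ : 0 < δ) (hδ1 : δ < 1) {N T : ℕ} (hN : 1 ≤ N) (hT : 1 ≤ T) (d : ℕ)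
    (hγ0 : 0 < γ) (hγ1 : γ ≤ (1 / 2) * ((N * T : ℕ) * (L ^ 2 / lam)))
    (hγ2 : (1 / 2) * Real.log (1 + (N * T : ℕ) * (κ ^ 2 / lam)) ≤ γ)
    (θ : H) (x : ℕ → E) (y η : ℕ → ℝ) (cand : ℕ → Set E)
    (hγ : info φ lam x (Finset.range (N * T)) ≤ 2 * γ) (hx : ∀ s < N * T, ‖φ (x s)‖ ≤ L)
    (hy : ∀ s < N * T, y s = inner ℝ θ (φ (x s)) + η s)
    (hcand : ∀ s < N * T, x s ∈ cand s ∧ IsMaxOn (ucb φ θ lam R δ N x y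
      (clientData N (lastSync φ lam (T / (N * γ)) N d x s) s (s % N))) (cand s) (x s))
    (h : ∀ s < N * T, NoiseBounded φ lam R δ N x η
      (clientData N (lastSync φ lam (T / (N * γ)) N d x s) s (s % N))) :
    regret φ θ cand x (N * T)
      ≤ regretConst lam R L κ δ * (Real.sqrt (N * T) * (‖θ‖ * Real.sqrt γ + γ)) := by
  have hN0 : (0 : ℝ) < N := by exact_mod_cast hN
  have h1 := regret_le_sum_playedWidth φ hlam hR θ x y η cand (N * T) hγ hy hcand h
  have h2 := sum_playedWidth_le φ hlam hL.le (show (0 : ℝ) ≤ T / (N * γ) by positivity) hN d x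
    (N * T) hx hγ
  have h3 := width_bound hlam hL hN hT hγ0 hγ1
  have h4 := alpha_bound hlam hR hκ hδ hδ1 hN hT (norm_nonneg θ) hγ2
  refine h1.trans ?_
  rw [mul_assoc]
  calc 2 * ((Real.sqrt lam * ‖θ‖ + R * Real.sqrt (4 * Real.log (N / δ) + 4 * γ))
        * ∑ s ∈ Finset.range (N * T), playedWidth φ lam (T / (N * γ)) N d x s)
      ≤ 2 * (((Real.sqrt lam + R * Real.sqrt (4 * (2 / min 1 (κ ^ 2 / lam)
        + 2 * Real.log (1 / δ) / Real.log (1 + κ ^ 2 / lam)) + 4)) * (‖θ‖ + Real.sqrt γ))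
        * ((Real.sqrt (Real.exp 1 * ((1 + L ^ 2 / lam) * 2)) + 2 * Real.sqrt (1 + L ^ 2 / lam)
        + 2 * (L / Real.sqrt lam) ^ 2) * (Real.sqrt (N * T) * Real.sqrt γ))) := by
        refine mul_le_mul_of_nonneg_left (mul_le_mul h4 (h2.trans h3) ?_ ?_) two_pos.le
        · exact Finset.sum_nonneg fun s _ => sigmaHat_nonneg φ lam x _ _
        · positivity
    _ = regretConst lam R L κ δ
        * (Real.sqrt (N * T) * (‖θ‖ * Real.sqrt γ + Real.sqrt γ * Real.sqrt γ)) := by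
        rw [regretConst]
        ring
    _ = _ := by rw [Real.mul_self_sqrt hγ0.le]

end Regret

/-! ### Gaussian integrals -/

section Gaussian

/-- The unnormalised standard Gaussian weight `exp (-|ξ| ^ 2 / 2)` on `ℝⁿ`. -/
def gaussWeight {n : ℕ} (ξ : Fin n → ℝ) : ℝ := Real.exp (-(1 / 2) * ∑ r, ξ r ^ 2)

/-- The total mass of the weight `exp (-|ξ| ^ 2 / 2)` on `ℝⁿ`. -/
def gaussMass (n : ℕ) : ENNReal := ∫⁻ ξ : Fin n → ℝ, ENNReal.ofReal (gaussWeight ξ)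

theorem measurable_gaussWeight (n : ℕ) : Measurable (gaussWeight : (Fin n → ℝ) → ℝ) := by
  unfold gaussWeight
  fun_prop

theorem gaussMass_ne_top (n : ℕ) : gaussMass n ≠ ⊤ := by
  have h : Integrable (gaussWeight : (Fin n → ℝ) → ℝ) := by
    have h1 : (gaussWeight : (Fin n → ℝ) → ℝ)
        = fun ξ => ∏ r, Real.exp (-(1 / 2) * ξ r ^ 2) := by
      funext ξ
      rw [gaussWeight, Finset.mul_sum, Real.exp_sum]
    rw [h1]
    exact Integrable.fintype_prod (f := fun _ (v : ℝ) => Real.exp (-(1 / 2) * v ^ 2))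
      fun _ => integrable_exp_neg_mul_sq (by norm_num)
  exact h.lintegral_lt_top.ne

theorem gaussMass_ne_zero (n : ℕ) : gaussMass n ≠ 0 := by
  rw [gaussMass, Ne, lintegral_eq_zero_iff (measurable_gaussWeight n).ennreal_ofReal]
  intro h
  have h1 : ∀ᵐ ξ : Fin n → ℝ, False := by
    filter_upwards [h] with ξ hξ
    have h2 : 0 < ENNReal.ofReal (gaussWeight ξ) := ENNReal.ofReal_pos.2 (Real.exp_pos _)
    exact absurd hξ h2.ne'
  have h3 := ae_iff.1 h1
  simp only [not_false_eq_true, Set.ofPred_true, Measure.measure_univ_eq_zero] at h3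
  exact NeZero.ne _ h3

open scoped MatrixOrder in
/-- A positive definite quadratic form is `|B ξ| ^ 2`, and the substitution `B ξ` has Jacobian `|det B|`. -/
theorem lintegral_exp_neg_quadratic {n : ℕ} (M : Matrix (Fin n) (Fin n) ℝ) (hM : M.PosDef) :
    ∫⁻ ξ : Fin n → ℝ, ENNReal.ofReal (Real.exp (-(1 / 2) * (ξ ⬝ᵥ M.mulVec ξ)))
      = ENNReal.ofReal (Real.sqrt M.det)⁻¹ * gaussMass n := by
  obtain ⟨B, hB⟩ := CStarAlgebra.nonneg_iff_eq_star_mul_self.mp hM.posSemidef.nonneg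
  rw [Matrix.star_eq_conjTranspose, Matrix.conjTranspose_eq_transpose_of_trivial] at hB
  have hdet : M.det = B.det ^ 2 := by rw [hB, Matrix.det_mul, Matrix.det_transpose, sq]
  have hB0 : B.det ≠ 0 := fun h => by
    have := hM.det_pos
    rw [hdet, h] at this
    simp at this
  have hquad : ∀ ξ : Fin n → ℝ, Real.exp (-(1 / 2) * (ξ ⬝ᵥ M.mulVec ξ))
      = gaussWeight (Matrix.toLin' B ξ) := by
    intro ξ
    rw [gaussWeight, hB, ← Matrix.mulVec_mulVec, Matrix.dotProduct_mulVec, Matrix.vecMul_transpose,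
      Matrix.toLin'_apply, dotProduct]
    simp only [sq]
  simp only [hquad]
  rw [← lintegral_map (f := fun ξ => ENNReal.ofReal (gaussWeight ξ))
      (measurable_gaussWeight n).ennreal_ofReal
      (Matrix.toLin' B).continuous_of_finiteDimensional.measurable,
    Real.map_matrix_volume_pi_eq_smul_volume_pi hB0, lintegral_smul_measure, gaussMass, hdet,
    Real.sqrt_sq_eq_abs, abs_inv, smul_eq_mul]

/-- A Gaussian integral with a linear term, in completed-square form. -/
theorem lintegral_exp_shifted_quadratic {n : ℕ} (M : Matrix (Fin n) (Fin n) ℝ) (hM : M.PosDef)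
    (ξ₀ : Fin n → ℝ) (c : ℝ) :
    ∫⁻ ξ : Fin n → ℝ, ENNReal.ofReal (Real.exp (c - (1 / 2) * ((ξ - ξ₀) ⬝ᵥ M.mulVec (ξ - ξ₀))))
      = ENNReal.ofReal (Real.exp c * (Real.sqrt M.det)⁻¹) * gaussMass n := by
  rw [lintegral_sub_right_eq_self (fun ξ : Fin n → ℝ =>
    ENNReal.ofReal (Real.exp (c - (1 / 2) * (ξ ⬝ᵥ M.mulVec ξ)))) ξ₀]
  have h : ∀ ξ : Fin n → ℝ, ENNReal.ofReal (Real.exp (c - (1 / 2) * (ξ ⬝ᵥ M.mulVec ξ)))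
      = ENNReal.ofReal (Real.exp c)
        * ENNReal.ofReal (Real.exp (-(1 / 2) * (ξ ⬝ᵥ M.mulVec ξ))) := by
    intro ξ
    rw [← ENNReal.ofReal_mul (Real.exp_nonneg _), ← Real.exp_add]
    congr 2
    ring
  simp only [h]
  rw [lintegral_const_mul _ (by
      have : Continuous fun ξ : Fin n → ℝ => ξ ⬝ᵥ M.mulVec ξ := by fun_prop
      fun_prop), lintegral_exp_neg_quadratic M hM, ← mul_assoc,
    ← ENNReal.ofReal_mul (Real.exp_nonneg _)]

end Gaussian

section Mixture

variable {E H : Type*} [NormedAddCommGroup H] [InnerProductSpace ℝ H]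

/-- The scale of the Gaussian mixture, chosen so that `mixScale ^ 2 * R ^ 2 / 2 = lam⁻¹`: the quadratic part
of `1 / 2` times the log-likelihood then adds `lam⁻¹ K` to the precision of the Gaussian. -/
def mixScale (lam R : ℝ) : ℝ := Real.sqrt (2 / (lam * R ^ 2))

/-- The random coefficient of interaction `s`: a Gaussian vector whose covariance matrix is the kernel
matrix up to the scale, if the rows `l s` are coordinates of the features. -/
def coef {n : ℕ} (lam R : ℝ) (l : ℕ → Fin n → ℝ) (ξ : Fin n → ℝ) (s : ℕ) : ℝ :=
  mixScale lam R * ∑ r, l s r * ξ r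

/-- The logarithm of the exponential supermartingale with coefficients `u` and noises `η`, over the index
set `S`. -/
def logLik (R : ℝ) (u η : ℕ → ℝ) (S : Finset ℕ) : ℝ :=
  ∑ s ∈ S, (u s * η s - u s ^ 2 * R ^ 2 / 2)

/-- The mixture over `ξ` of the square roots of the exponential supermartingales, over a data set `S`, is
determined by the noise form and the determinant of `S`: with `u = ν L ξ` and `L Lᵀ = K` the exponent is a
quadratic in `ξ` with Hessian `M = 1 + lam⁻¹ LᵀL`, and `det M = det (1 + lam⁻¹ L Lᵀ)`. -/
theorem lintegral_exp_half_logLik (φ : E → H) {lam R : ℝ} (hlam : 0 < lam) (hR : 0 < R) (x : ℕ → E)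
    (η : ℕ → ℝ) (S : Finset ℕ) {n : ℕ} (l : ℕ → Fin n → ℝ)
    (hl : ∀ s ∈ S, ∀ s' ∈ S, ∑ r, l s r * l s' r = kernel φ (x s) (x s')) :
    ∫⁻ ξ : Fin n → ℝ, ENNReal.ofReal
        (Real.exp ((1 / 2) * logLik R (coef lam R l ξ) η S) * gaussWeight ξ)
      = ENNReal.ofReal (Real.exp (noiseForm φ lam x η S / (4 * R ^ 2))
        * (Real.sqrt (dataDet φ lam x S))⁻¹) * gaussMass n := by
  set Lm : Matrix S (Fin n) ℝ := Matrix.of fun s r => l s r with hLm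
  set ν := mixScale lam R with hν
  have hν2 : ν ^ 2 = 2 / (lam * R ^ 2) := Real.sq_sqrt (by positivity)
  set a : S → ℝ := (ridgeInv φ lam x S).mulVec fun s : S => η s with ha
  have hK : Lm * Lm.transpose = kernelMatrix φ fun s : S => x s := by
    ext s s'
    simp only [Matrix.mul_apply, hLm, Matrix.of_apply, Matrix.transpose_apply, kernelMatrix]
    exact hl s s.2 s' s'.2
  set M : Matrix (Fin n) (Fin n) ℝ := 1 + lam⁻¹ • (Lm.transpose * Lm) with hM
  have hMpos : M.PosDef := by
    refine Matrix.PosDef.one.add_posSemidef (Matrix.PosSemidef.smul ?_ (inv_nonneg.2 hlam.le))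
    have := Matrix.posSemidef_conjTranspose_mul_self Lm
    rwa [Matrix.conjTranspose_eq_transpose_of_trivial] at this
  have hdet : M.det = dataDet φ lam x S := by
    rw [dataDet, infoDet, ← hK, hM, ← Matrix.mul_smul, Matrix.det_one_add_mul_comm, Matrix.smul_mul]
  have hKa : ∀ s : S, (kernelMatrix φ fun s : S => x s).mulVec a s = η s - lam * a s := fun s =>
    mulVec_ridgeInv_mulVec φ hlam x S (fun s : S => η s) s
  -- the maximizer of the exponent, expressed through `(K + lam)⁻¹` instead of `M⁻¹`
  set ξ₀ : Fin n → ℝ := ((1 / 2) * ν * lam) • Lm.transpose.mulVec a with hξ₀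
  have hMξ₀ : M.mulVec ξ₀ = ((1 / 2) * ν) • Lm.transpose.mulVec fun s : S => η s := by
    have h1 : (Lm.transpose * Lm).mulVec (Lm.transpose.mulVec a)
        = Lm.transpose.mulVec (fun s : S => η s) - lam • Lm.transpose.mulVec a := by
      rw [← Matrix.mulVec_mulVec, Matrix.mulVec_mulVec _ Lm, hK, ← Matrix.mulVec_smul,
        ← Matrix.mulVec_sub]
      congr 1
      funext s
      exact hKa s
    rw [hM, Matrix.add_mulVec, Matrix.one_mulVec, Matrix.smul_mulVec, hξ₀, Matrix.mulVec_smul, h1]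
    funext r
    simp only [Pi.add_apply, Pi.smul_apply, Pi.sub_apply, smul_eq_mul]
    field_simp
    ring
  have hnoise : noiseForm φ lam x η S
      = (fun s : S => η s) ⬝ᵥ (kernelMatrix φ fun s : S => x s).mulVec a := by
    rw [noiseForm, precForm_ridgeEst φ hlam, dotProduct, ← Finset.sum_coe_sort S]
    refine Finset.sum_congr rfl fun s _ => ?_
    rw [ridgeEst, inner_sum, Matrix.mulVec, dotProduct]
    congr 1
    refine Finset.sum_congr rfl fun r _ => ?_
    rw [inner_smul_right, kernelMatrix, Matrix.of_apply, kernel, mul_comm]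
  have hcoef : ∀ (ξ : Fin n → ℝ) (s : S), coef lam R l ξ s = ν * Lm.mulVec ξ s := fun ξ s => rfl
  have hexp : ∀ ξ : Fin n → ℝ,
      (1 / 2) * logLik R (coef lam R l ξ) η S + -(1 / 2) * ∑ r, ξ r ^ 2
        = noiseForm φ lam x η S / (4 * R ^ 2)
          - (1 / 2) * ((ξ - ξ₀) ⬝ᵥ M.mulVec (ξ - ξ₀)) := by
    intro ξ
    have h1 : logLik R (coef lam R l ξ) η S
        = ν * ((fun s : S => η s) ⬝ᵥ Lm.mulVec ξ)
          - lam⁻¹ * (Lm.mulVec ξ ⬝ᵥ Lm.mulVec ξ) := by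
      rw [logLik, ← Finset.sum_coe_sort S]
      simp only [hcoef, dotProduct, Finset.mul_sum]
      rw [← Finset.sum_sub_distrib]
      refine Finset.sum_congr rfl fun s _ => ?_
      rw [mul_pow, hν2]
      field_simp
    have hsymm : ∀ v w : Fin n → ℝ, v ⬝ᵥ M.mulVec w = w ⬝ᵥ M.mulVec v := by
      intro v w
      rw [Matrix.dotProduct_mulVec, ← Matrix.mulVec_transpose, dotProduct_comm]
      congr 2
      have := hMpos.isHermitian
      rwa [Matrix.IsHermitian, Matrix.conjTranspose_eq_transpose_of_trivial] at this
    have hadj : ∀ v : Fin n → ℝ, v ⬝ᵥ Lm.transpose.mulVec (fun s : S => η s)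
        = (fun s : S => η s) ⬝ᵥ Lm.mulVec v := by
      intro v
      rw [Matrix.dotProduct_mulVec, Matrix.vecMul_transpose, dotProduct_comm]
    have h2 : ξ ⬝ᵥ M.mulVec ξ₀ = (1 / 2) * ν * ((fun s : S => η s) ⬝ᵥ Lm.mulVec ξ) := by
      rw [hMξ₀, dotProduct_smul, hadj, smul_eq_mul]
    have h3 : ξ₀ ⬝ᵥ M.mulVec ξ₀ = noiseForm φ lam x η S / (2 * R ^ 2) := by
      rw [hMξ₀, dotProduct_smul, hadj, hξ₀, Matrix.mulVec_smul, dotProduct_smul,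
        Matrix.mulVec_mulVec, hK, ← hnoise, smul_eq_mul, smul_eq_mul]
      have : 1 / 2 * ν * (1 / 2 * ν * lam * noiseForm φ lam x η S)
          = ν ^ 2 * lam * noiseForm φ lam x η S / 4 := by ring
      rw [this, hν2]
      field_simp
      ring
    have h4 : ξ ⬝ᵥ M.mulVec ξ = ∑ r, ξ r ^ 2 + lam⁻¹ * (Lm.mulVec ξ ⬝ᵥ Lm.mulVec ξ) := by
      rw [hM, Matrix.add_mulVec, Matrix.one_mulVec, dotProduct_add, Matrix.smul_mulVec,
        dotProduct_smul, ← Matrix.mulVec_mulVec, Matrix.dotProduct_mulVec ξ,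
        Matrix.vecMul_transpose, smul_eq_mul]
      congr 1
      exact Finset.sum_congr rfl fun r _ => (sq _).symm
    rw [Matrix.mulVec_sub, sub_dotProduct, dotProduct_sub, dotProduct_sub, hsymm ξ₀ ξ, h2, h3, h4, h1]
    field_simp
    ring
  have hint : ∀ ξ : Fin n → ℝ,
      Real.exp ((1 / 2) * logLik R (coef lam R l ξ) η S) * gaussWeight ξ
        = Real.exp (noiseForm φ lam x η S / (4 * R ^ 2)
          - (1 / 2) * ((ξ - ξ₀) ⬝ᵥ M.mulVec (ξ - ξ₀))) := by
    intro ξ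
    rw [gaussWeight, ← Real.exp_add, hexp]
  simp only [hint]
  rw [lintegral_exp_shifted_quadratic M hMpos, hdet]

end Mixture

/-! ### The potential of an epoch -/

section Potential

theorem logLik_union {R : ℝ} {u η : ℕ → ℝ} {S S' : Finset ℕ} (h : Disjoint S S') :
    logLik R u η (S ∪ S') = logLik R u η S + logLik R u η S' :=
  Finset.sum_union h

theorem logLik_insert {R : ℝ} {u η : ℕ → ℝ} {S : Finset ℕ} {t : ℕ} (h : t ∉ S) :
    logLik R u η (insert t S) = (u t * η t - u t ^ 2 * R ^ 2 / 2) + logLik R u η S :=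
  Finset.sum_insert h

theorem sum_logLik_localData {N : ℕ} (hN : 1 ≤ N) (R : ℝ) (u η : ℕ → ℝ) (τ t : ℕ) :
    ∑ j ∈ Finset.range N, logLik R u η (localData N τ t j) = logLik R u η (Finset.Ico τ t) :=
  Finset.sum_fiberwise_of_maps_to (g := fun s => s % N)
    (fun s _ => Finset.mem_range.2 (Nat.mod_lt s hN)) _

/-- The potential after `t` interactions, if the last synchronization took place after `τ` interactions.
With `m` the exponential supermartingale of the synchronized data, `eⱼ` that of the local data of client
`j` and `a = ∏ eⱼ`, it is `√m (1 + ∑ⱼ eⱼ + (N - 1) a) / 2`. -/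
def potential (N : ℕ) (R : ℝ) (u η : ℕ → ℝ) (τ t : ℕ) : ℝ :=
  (1 / 2) * Real.exp ((1 / 2) * logLik R u η (Finset.range τ))
    * (1 + ∑ j ∈ Finset.range N, Real.exp (logLik R u η (localData N τ t j))
      + (N - 1) * Real.exp (logLik R u η (Finset.Ico τ t)))

theorem potential_self (N : ℕ) (R : ℝ) (u η : ℕ → ℝ) (t : ℕ) :
    potential N R u η t t = N * Real.exp ((1 / 2) * logLik R u η (Finset.range t)) := by
  simp only [potential, localData_self, Finset.Ico_self, logLik, Finset.sum_empty, Real.exp_zero,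
    Finset.sum_const, Finset.card_range, nsmul_eq_mul]
  ring

theorem potential_zero (N : ℕ) (R : ℝ) (u η : ℕ → ℝ) : potential N R u η 0 0 = N := by
  simp [potential_self, logLik]

/-- A synchronization does not increase the potential: this is the inequality
`1 + ∑ⱼ eⱼ + (N - 1) a ≥ 2 N √a` between the arithmetic and the geometric mean. -/
theorem potential_sync_le {N : ℕ} (hN : 1 ≤ N) (R : ℝ) (u η : ℕ → ℝ) {τ t : ℕ} (h : τ ≤ t) :
    potential N R u η t t ≤ potential N R u η τ t := by
  have hr : Finset.range t = Finset.range τ ∪ Finset.Ico τ t := by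
    ext s
    simp only [Finset.mem_union, Finset.mem_range, Finset.mem_Ico]
    omega
  have hd : Disjoint (Finset.range τ) (Finset.Ico τ t) :=
    Finset.disjoint_left.2 fun s h1 h2 =>
      absurd (Finset.mem_Ico.1 h2).1 (not_le.2 (Finset.mem_range.1 h1))
  have hN' : (0 : ℝ) ≤ N - 1 := sub_nonneg.2 (by exact_mod_cast hN)
  rw [potential_self, hr, logLik_union hd, mul_add, Real.exp_add, potential]
  set b : ℕ → ℝ := fun j => logLik R u η (localData N τ t j)
  set a := logLik R u η (Finset.Ico τ t) with ha
  have hsum : ∑ j ∈ Finset.range N, b j = a := sum_logLik_localData hN R u η τ t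
  -- the tangent of `exp` at the mean `a / 2` of the `2 N` exponents
  have tangent : ∀ v : ℝ, Real.exp (1 / 2 * a) * (1 + (v - 1 / 2 * a)) ≤ Real.exp v := by
    intro v
    have h1 := Real.add_one_le_exp (v - 1 / 2 * a)
    calc Real.exp (1 / 2 * a) * (1 + (v - 1 / 2 * a))
        ≤ Real.exp (1 / 2 * a) * Real.exp (v - 1 / 2 * a) :=
          mul_le_mul_of_nonneg_left (by linarith) (Real.exp_nonneg _)
      _ = Real.exp v := by rw [← Real.exp_add]; congr 1; ring
  have h0 := tangent 0
  rw [Real.exp_zero] at h0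
  have h1 : Real.exp (1 / 2 * a) * (N + (a - N * (1 / 2 * a)))
      ≤ ∑ j ∈ Finset.range N, Real.exp (b j) := by
    calc _ = ∑ j ∈ Finset.range N, Real.exp (1 / 2 * a) * (1 + (b j - 1 / 2 * a)) := by
          rw [← Finset.mul_sum, Finset.sum_add_distrib, Finset.sum_sub_distrib, hsum]
          simp
      _ ≤ _ := Finset.sum_le_sum fun j _ => tangent (b j)
  have h2 := mul_le_mul_of_nonneg_left (tangent a) hN'
  have key : 2 * N * Real.exp (1 / 2 * a)
      ≤ 1 + ∑ j ∈ Finset.range N, Real.exp (b j) + (N - 1) * Real.exp a := by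
    nlinarith
  have h3 := mul_le_mul_of_nonneg_left key
    (Real.exp_nonneg (1 / 2 * logLik R u η (Finset.range τ)))
  linarith

/-- The potential dominates the square root of the exponential supermartingale of every data set. -/
theorem exp_half_logLik_clientData_le {N : ℕ} (R : ℝ) (u η : ℕ → ℝ) (τ t : ℕ) {j : ℕ}
    (hj : j < N) :
    Real.exp ((1 / 2) * logLik R u η (clientData N τ t j)) ≤ potential N R u η τ t := by
  rw [clientData, logLik_union (disjoint_range_localData N τ t j), mul_add, Real.exp_add, potential,
    mul_comm (1 / 2) (Real.exp _), mul_assoc]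
  refine mul_le_mul_of_nonneg_left ?_ (Real.exp_nonneg _)
  have hN' : (0 : ℝ) ≤ N - 1 := sub_nonneg.2 (by exact_mod_cast Nat.one_le_of_lt hj)
  have h1 : Real.exp (logLik R u η (localData N τ t j))
      ≤ ∑ j ∈ Finset.range N, Real.exp (logLik R u η (localData N τ t j)) :=
    Finset.single_le_sum (f := fun j => Real.exp (logLik R u η (localData N τ t j)))
      (fun _ _ => Real.exp_nonneg _) (Finset.mem_range.2 hj)
  have h2 : 0 ≤ (N - 1) * Real.exp (logLik R u η (Finset.Ico τ t)) :=
    mul_nonneg hN' (Real.exp_nonneg _)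
  have h3 : Real.exp (logLik R u η (localData N τ t j))
      = Real.exp (1 / 2 * logLik R u η (localData N τ t j)) ^ 2 := by
    rw [← Real.exp_nat_mul]
    congr 1
    push_cast
    ring
  nlinarith [sq_nonneg (Real.exp (1 / 2 * logLik R u η (localData N τ t j)) - 1)]

/-- The part of the potential that does not change at interaction `t`. -/
def potentialRest (N : ℕ) (R : ℝ) (u η : ℕ → ℝ) (τ t : ℕ) : ℝ :=
  (1 / 2) * Real.exp ((1 / 2) * logLik R u η (Finset.range τ))
    * (1 + ∑ j ∈ (Finset.range N).erase (t % N), Real.exp (logLik R u η (localData N τ t j)))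

/-- The part of the potential that interaction `t` multiplies by its likelihood ratio: the terms that involve
the local data of client `t % N`. -/
def potentialFactor (N : ℕ) (R : ℝ) (u η : ℕ → ℝ) (τ t : ℕ) : ℝ :=
  (1 / 2) * Real.exp ((1 / 2) * logLik R u η (Finset.range τ))
    * (Real.exp (logLik R u η (localData N τ t (t % N)))
      + (N - 1) * Real.exp (logLik R u η (Finset.Ico τ t)))

theorem potentialRest_nonneg (N : ℕ) (R : ℝ) (u η : ℕ → ℝ) (τ t : ℕ) :
    0 ≤ potentialRest N R u η τ t := by
  rw [potentialRest]
  positivity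

theorem potentialFactor_nonneg {N : ℕ} (hN : 1 ≤ N) (R : ℝ) (u η : ℕ → ℝ) (τ t : ℕ) :
    0 ≤ potentialFactor N R u η τ t := by
  have hN' : (0 : ℝ) ≤ N - 1 := sub_nonneg.2 (by exact_mod_cast hN)
  rw [potentialFactor]
  positivity

theorem potential_eq_add {N : ℕ} (hN : 1 ≤ N) (R : ℝ) (u η : ℕ → ℝ) (τ t : ℕ) :
    potential N R u η τ t = potentialRest N R u η τ t + potentialFactor N R u η τ t := by
  rw [potential, potentialRest, potentialFactor,
    ← Finset.add_sum_erase _ _ (Finset.mem_range.2 (Nat.mod_lt t hN))]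
  ring

theorem potential_succ {N : ℕ} (hN : 1 ≤ N) (R : ℝ) (u η : ℕ → ℝ) {τ t : ℕ} (h : τ ≤ t) :
    potential N R u η τ (t + 1) = potentialRest N R u η τ t
      + potentialFactor N R u η τ t * Real.exp (u t * η t - u t ^ 2 * R ^ 2 / 2) := by
  have h1 : logLik R u η (localData N τ (t + 1) (t % N))
      = (u t * η t - u t ^ 2 * R ^ 2 / 2) + logLik R u η (localData N τ t (t % N)) := by
    rw [localData_succ h, if_pos rfl, logLik_insert fun h => lt_irrefl t (mem_localData.1 h).1.2]
  have h2 : logLik R u η (Finset.Ico τ (t + 1))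
      = (u t * η t - u t ^ 2 * R ^ 2 / 2) + logLik R u η (Finset.Ico τ t) := by
    rw [← Finset.insert_Ico_right_eq_Ico_add_one h, logLik_insert Finset.right_notMem_Ico]
  have h3 : ∑ j ∈ (Finset.range N).erase (t % N),
      Real.exp (logLik R u η (localData N τ (t + 1) j))
      = ∑ j ∈ (Finset.range N).erase (t % N), Real.exp (logLik R u η (localData N τ t j)) := by
    refine Finset.sum_congr rfl fun j hj => ?_
    rw [localData_succ h, if_neg (Finset.ne_of_mem_erase hj).symm]
  rw [potential, potentialRest, potentialFactor,
    ← Finset.add_sum_erase _ _ (Finset.mem_range.2 (Nat.mod_lt t hN)), h1, h2, h3, Real.exp_add,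
    Real.exp_add]
  ring

end Potential

/-! ### Conditionally sub-Gaussian noise -/

section SubGaussian

variable {Ω : Type*}

/-- The exponential supermartingale inequality with a constant coefficient `u`, for a nonnegative weight `Y`
known before the noise: on the σ-algebra `m`, the measure with density `exp (u ξ - u ^ 2 R ^ 2 / 2)` is at
most `μ`. -/
theorem lintegral_mul_exp_le {m m0 : MeasurableSpace Ω} (hm : m ≤ m0) {μ : Measure Ω}
    [IsProbabilityMeasure μ] {ξ : Ω → ℝ} {R : ℝ} (hξ : Measurable[m0] ξ)
    (h : CondSubGaussian μ m ξ R) {Y : Ω → ENNReal} (hY : Measurable[m] Y) (u : ℝ) :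
    ∫⁻ ω, Y ω * ENNReal.ofReal (Real.exp (u * ξ ω - u ^ 2 * R ^ 2 / 2)) ∂μ ≤ ∫⁻ ω, Y ω ∂μ := by
  obtain ⟨hint, hle⟩ := h.2.2 u
  set g : Ω → ENNReal := fun ω => ENNReal.ofReal (Real.exp (u * ξ ω - u ^ 2 * R ^ 2 / 2)) with hg
  have hgm : Measurable[m0] g := by fun_prop
  have hset : ∀ s, MeasurableSet[m] s → ∫⁻ ω in s, g ω ∂μ ≤ μ s := by
    intro s hs
    have h1 : ∀ ω, Real.exp (u * ξ ω - u ^ 2 * R ^ 2 / 2)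
        = Real.exp (-(u ^ 2 * R ^ 2 / 2)) * Real.exp (u * ξ ω) := fun ω => by
      rw [← Real.exp_add]; congr 1; ring
    have h2 : ∫ ω in s, Real.exp (u * ξ ω) ∂μ ≤ Real.exp (u ^ 2 * R ^ 2 / 2) * μ.real s := by
      rw [← setIntegral_condExp hm hint hs]
      calc _ ≤ ∫ _ in s, Real.exp (u ^ 2 * R ^ 2 / 2) ∂μ :=
            setIntegral_mono_ae integrable_condExp.integrableOn
              (integrable_const _).integrableOn hle
        _ = _ := by rw [setIntegral_const, smul_eq_mul, mul_comm]
    rw [hg, ← ofReal_integral_eq_lintegral_ofReal]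
    · simp only [h1]
      rw [integral_const_mul]
      calc _ ≤ ENNReal.ofReal (Real.exp (-(u ^ 2 * R ^ 2 / 2))
            * (Real.exp (u ^ 2 * R ^ 2 / 2) * μ.real s)) :=
            ENNReal.ofReal_le_ofReal (mul_le_mul_of_nonneg_left h2 (Real.exp_nonneg _))
        _ = μ s := by
            rw [← mul_assoc, ← Real.exp_add, neg_add_cancel, Real.exp_zero, one_mul,
              ofReal_measureReal]
    · simp only [h1]
      exact (hint.const_mul _).integrableOn
    · exact Filter.Eventually.of_forall fun _ => Real.exp_nonneg _
  have htrim : (μ.withDensity g).trim hm ≤ μ.trim hm := by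
    refine Measure.le_iff.2 fun s hs => ?_
    rw [trim_measurableSet_eq hm hs, trim_measurableSet_eq hm hs, withDensity_apply _ (hm s hs)]
    exact hset s hs
  calc ∫⁻ ω, Y ω * g ω ∂μ = ∫⁻ ω, Y ω ∂(μ.withDensity g) := by
        rw [lintegral_withDensity_eq_lintegral_mul _ hgm (hY.mono hm le_rfl)]
        simp only [Pi.mul_apply, mul_comm]
    _ = ∫⁻ ω, Y ω ∂((μ.withDensity g).trim hm) := (lintegral_trim hm hY).symm
    _ ≤ ∫⁻ ω, Y ω ∂(μ.trim hm) := lintegral_mono' htrim le_rfl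
    _ = _ := lintegral_trim hm hY

/-- The exponential supermartingale inequality with a coefficient `v` that is known before the noise:
simple functions `v` reduce to constant ones, and Fatou's lemma gives the general case. -/
theorem lintegral_mul_exp_le_of_measurable {m m0 : MeasurableSpace Ω} (hm : m ≤ m0) {μ : Measure Ω}
    [IsProbabilityMeasure μ] {ξ : Ω → ℝ} {R : ℝ} (hξ : Measurable[m0] ξ)
    (h : CondSubGaussian μ m ξ R) {Y : Ω → ENNReal} (hY : Measurable[m] Y) {v : Ω → ℝ}
    (hv : Measurable[m] v) :
    ∫⁻ ω, Y ω * ENNReal.ofReal (Real.exp (v ω * ξ ω - v ω ^ 2 * R ^ 2 / 2)) ∂μ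
      ≤ ∫⁻ ω, Y ω ∂μ := by
  have hsimple : ∀ w : Ω → ℝ, Measurable[m] w → (Set.range w).Finite →
      ∫⁻ ω, Y ω * ENNReal.ofReal (Real.exp (w ω * ξ ω - w ω ^ 2 * R ^ 2 / 2)) ∂μ
        ≤ ∫⁻ ω, Y ω ∂μ := by
    intro w hw hfin
    have hsum : ∀ F : ℝ → Ω → ENNReal, ∀ ω, Y ω * F (w ω) ω
        = ∑ c ∈ hfin.toFinset, (w ⁻¹' {c}).indicator Y ω * F c ω := by
      intro F ω
      rw [Finset.sum_eq_single_of_mem (w ω) (hfin.mem_toFinset.2 (Set.mem_range_self ω))]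
      · rw [Set.indicator_of_mem (by simp)]
      · intro c _ hc
        rw [Set.indicator_of_notMem (by simpa using hc.symm), zero_mul]
    have hYc : ∀ c, Measurable[m] ((w ⁻¹' {c}).indicator Y) := fun c =>
      hY.indicator (hw (measurableSet_singleton c))
    have hm' : ∀ c, Measurable[m0] fun ω => (w ⁻¹' {c}).indicator Y ω
        * ENNReal.ofReal (Real.exp (c * ξ ω - c ^ 2 * R ^ 2 / 2)) := fun c =>
      ((hYc c).mono hm le_rfl).mul (by fun_prop)
    calc _ = ∑ c ∈ hfin.toFinset, ∫⁻ ω, (w ⁻¹' {c}).indicator Y ω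
          * ENNReal.ofReal (Real.exp (c * ξ ω - c ^ 2 * R ^ 2 / 2)) ∂μ := by
          rw [← lintegral_finsetSum _ fun c _ => hm' c]
          exact lintegral_congr fun ω =>
            hsum (fun c ω => ENNReal.ofReal (Real.exp (c * ξ ω - c ^ 2 * R ^ 2 / 2))) ω
      _ ≤ ∑ c ∈ hfin.toFinset, ∫⁻ ω, (w ⁻¹' {c}).indicator Y ω ∂μ :=
          Finset.sum_le_sum fun c _ => lintegral_mul_exp_le hm hξ h (hYc c) c
      _ = ∫⁻ ω, Y ω ∂μ := by
          rw [← lintegral_finsetSum _ fun c _ => (hYc c).mono hm le_rfl]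
          refine lintegral_congr fun ω => ?_
          simpa using (hsum (fun _ _ => 1) ω).symm
  have hvs : StronglyMeasurable[m] v := hv.stronglyMeasurable
  have hlim : ∀ ω, Filter.Tendsto (fun k => Y ω * ENNReal.ofReal
      (Real.exp (hvs.approx k ω * ξ ω - hvs.approx k ω ^ 2 * R ^ 2 / 2))) Filter.atTop
      (nhds (Y ω * ENNReal.ofReal (Real.exp (v ω * ξ ω - v ω ^ 2 * R ^ 2 / 2)))) := by
    intro ω
    refine ENNReal.Tendsto.const_mul ?_ (Or.inl (ENNReal.ofReal_pos.2 (Real.exp_pos _)).ne')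
    have hc : Continuous fun c : ℝ => ENNReal.ofReal (Real.exp (c * ξ ω - c ^ 2 * R ^ 2 / 2)) :=
      ENNReal.continuous_ofReal.comp (by fun_prop)
    exact (hc.tendsto (v ω)).comp (hvs.tendsto_approx ω)
  calc _ = ∫⁻ ω, Filter.liminf (fun k => Y ω * ENNReal.ofReal
        (Real.exp (hvs.approx k ω * ξ ω - hvs.approx k ω ^ 2 * R ^ 2 / 2))) Filter.atTop ∂μ :=
        lintegral_congr fun ω => (hlim ω).liminf_eq.symm
    _ ≤ Filter.liminf (fun k => ∫⁻ ω, Y ω * ENNReal.ofReal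
        (Real.exp (hvs.approx k ω * ξ ω - hvs.approx k ω ^ 2 * R ^ 2 / 2)) ∂μ) Filter.atTop := by
        refine lintegral_liminf_le fun k => (hY.mono hm le_rfl).mul ?_
        have hk : Measurable[m0] (hvs.approx k) :=
          (@SimpleFunc.measurable Ω ℝ m _ (hvs.approx k)).mono hm le_rfl
        fun_prop
    _ ≤ ∫⁻ ω, Y ω ∂μ := by
        refine Filter.liminf_le_of_le (by isBoundedDefault) fun b hb => ?_
        obtain ⟨k, hk⟩ := hb.exists
        exact hk.trans (hsimple _ (@SimpleFunc.measurable Ω ℝ m _ (hvs.approx k))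
          (@SimpleFunc.finite_range Ω ℝ m (hvs.approx k)))

/-- One step of the supermartingale: multiplying the part `b` of `a + b` by a likelihood ratio with
predictable coefficient `v` does not increase the integral over an event of the past. -/
theorem setLIntegral_le_of_le_add_mul_exp {m m0 : MeasurableSpace Ω} (hm : m ≤ m0) {μ : Measure Ω}
    [IsProbabilityMeasure μ] {ξ : Ω → ℝ} {R : ℝ} (hξ : Measurable[m0] ξ)
    (h : CondSubGaussian μ m ξ R) {B : Set Ω} (hB : MeasurableSet[m] B) {a b v p q : Ω → ℝ} {g : ℝ}
    (hg : 0 ≤ g) (ha : ∀ ω, 0 ≤ a ω) (hb : ∀ ω, 0 ≤ b ω) (hbm : Measurable[m] b)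
    (hv : Measurable[m] v)
    (hp : ∀ ω, p ω ≤ a ω + b ω * Real.exp (v ω * ξ ω - v ω ^ 2 * R ^ 2 / 2))
    (hq : ∀ ω, a ω + b ω ≤ q ω) :
    ∫⁻ ω in B, ENNReal.ofReal (p ω * g) ∂μ ≤ ∫⁻ ω in B, ENNReal.ofReal (q ω * g) ∂μ := by
  have hgm : Measurable[m] fun ω => ENNReal.ofReal (b ω * g) := (hbm.mul_const _).ennreal_ofReal
  have ha0 : ∀ ω, 0 ≤ a ω * g := fun ω => mul_nonneg (ha ω) hg
  have hb0 : ∀ ω, 0 ≤ b ω * g := fun ω => mul_nonneg (hb ω) hg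
  have hgm0 := hgm.mono hm le_rfl
  have hv0 := hv.mono hm le_rfl
  have hexp : Measurable[m0] fun ω => ENNReal.ofReal (b ω * g)
      * ENNReal.ofReal (Real.exp (v ω * ξ ω - v ω ^ 2 * R ^ 2 / 2)) :=
    hgm0.mul (by fun_prop)
  have key : ∫⁻ ω in B, ENNReal.ofReal (b ω * g)
        * ENNReal.ofReal (Real.exp (v ω * ξ ω - v ω ^ 2 * R ^ 2 / 2)) ∂μ
      ≤ ∫⁻ ω in B, ENNReal.ofReal (b ω * g) ∂μ := by
    rw [← lintegral_indicator (hm _ hB), ← lintegral_indicator (hm _ hB)]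
    refine le_trans (le_of_eq (lintegral_congr fun ω => ?_))
      (lintegral_mul_exp_le_of_measurable hm hξ h (hgm.indicator hB) hv)
    by_cases hω : ω ∈ B <;> simp [hω]
  calc _ ≤ ∫⁻ ω in B, (ENNReal.ofReal (a ω * g) + ENNReal.ofReal (b ω * g)
          * ENNReal.ofReal (Real.exp (v ω * ξ ω - v ω ^ 2 * R ^ 2 / 2))) ∂μ := by
        refine lintegral_mono fun ω => ?_
        rw [← ENNReal.ofReal_mul (hb0 ω), ← ENNReal.ofReal_add (ha0 ω)
          (mul_nonneg (hb0 ω) (Real.exp_nonneg _))]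
        refine ENNReal.ofReal_le_ofReal ((mul_le_mul_of_nonneg_right (hp ω) hg).trans_eq ?_)
        ring
    _ ≤ ∫⁻ ω in B, ENNReal.ofReal (a ω * g) ∂μ + ∫⁻ ω in B, ENNReal.ofReal (b ω * g) ∂μ := by
        rw [lintegral_add_right _ hexp]
        exact add_le_add le_rfl key
    _ ≤ _ := by
        rw [← lintegral_add_right _ hgm0]
        refine lintegral_mono fun ω => ?_
        rw [← ENNReal.ofReal_add (ha0 ω) (hb0 ω), ← add_mul]
        exact ENNReal.ofReal_le_ofReal (mul_le_mul_of_nonneg_right (hq ω) hg)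

/-- Ville's maximal inequality for a process `Ψ` with values in `[0, ∞]` that is a supermartingale up to
time `n`. -/
theorem mul_measure_exists_lt_le {m0 : MeasurableSpace Ω} {μ : Measure Ω}
    (m : ℕ → MeasurableSpace Ω) (n : ℕ) (hm : ∀ t < n, m t ≤ m0) (hmono : Monotone m)
    (Ψ : ℕ → Ω → ENNReal) (hΨ : ∀ t < n, Measurable[m t] (Ψ t))
    (hstep : ∀ t < n, ∀ B, MeasurableSet[m t] B →
      ∫⁻ ω in B, Ψ (t + 1) ω ∂μ ≤ ∫⁻ ω in B, Ψ t ω ∂μ) (c : ENNReal) :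
    c * μ {ω | ∃ t < n, c < Ψ t ω} ≤ ∫⁻ ω, Ψ 0 ω ∂μ := by
  -- the process is stopped when it exceeds `c`, and there replaced by `c`
  have key : ∀ t ≤ n, c * μ {ω | ∃ s < t, c < Ψ s ω}
      + ∫⁻ ω in {ω | ∃ s < t, c < Ψ s ω}ᶜ, Ψ t ω ∂μ ≤ ∫⁻ ω, Ψ 0 ω ∂μ := by
    intro t
    induction t with
    | zero => intro _; simp
    | succ t ih =>
      intro ht
      have htn : t < n := ht
      set U : Set Ω := {ω | ∃ s < t, c < Ψ s ω} with hU
      set V : Set Ω := {ω | c < Ψ t ω} with hV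
      have hUm : MeasurableSet[m t] U := by
        have : U = ⋃ s ∈ Set.Iio t, {ω | c < Ψ s ω} := by ext ω; simp [hU]
        rw [this]
        refine MeasurableSet.biUnion (Set.to_countable _) fun s hs => ?_
        exact hmono (le_of_lt hs) _ (measurableSet_lt measurable_const (hΨ s (hs.trans htn)))
      have hVm : MeasurableSet[m t] V := measurableSet_lt measurable_const (hΨ t htn)
      have hUV : {ω | ∃ s < t + 1, c < Ψ s ω} = U ∪ V := by
        ext ω
        simp only [hU, hV, Set.mem_ofPred_eq, Set.mem_union, Nat.lt_succ_iff_lt_or_eq]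
        constructor
        · rintro ⟨s, hs | rfl, h⟩
          · exact Or.inl ⟨s, hs, h⟩
          · exact Or.inr h
        · rintro (⟨s, hs, h⟩ | h)
          · exact ⟨s, Or.inl hs, h⟩
          · exact ⟨t, Or.inr rfl, h⟩
      rw [hUV]
      have h1 : c * μ (U ∪ V) ≤ c * μ U + ∫⁻ ω in Uᶜ ∩ V, Ψ t ω ∂μ := by
        have h2 : U ∪ V = U ∪ (Uᶜ ∩ V) := by
          ext ω
          by_cases hω : ω ∈ U <;> simp [hω]
        rw [h2]
        refine (mul_le_mul_right (measure_union_le _ _) c).trans ?_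
        rw [mul_add]
        gcongr
        rw [← setLIntegral_const]
        refine setLIntegral_mono' (hm t htn _ (hUm.compl.inter hVm)) fun ω hω => ?_
        exact (show c < Ψ t ω from hω.2).le
      have h3 : ∫⁻ ω in (U ∪ V)ᶜ, Ψ (t + 1) ω ∂μ ≤ ∫⁻ ω in Uᶜ \ V, Ψ t ω ∂μ := by
        rw [Set.compl_union, ← Set.sdiff_eq]
        exact hstep t htn _ (hUm.compl.diff hVm)
      calc _ ≤ c * μ U + ∫⁻ ω in Uᶜ ∩ V, Ψ t ω ∂μ + ∫⁻ ω in Uᶜ \ V, Ψ t ω ∂μ :=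
            add_le_add h1 h3
        _ = c * μ U + ∫⁻ ω in Uᶜ, Ψ t ω ∂μ := by
            rw [add_assoc, lintegral_inter_add_sdiff _ _ (hm t htn _ hVm)]
        _ ≤ _ := ih htn.le
  exact le_self_add.trans (key n le_rfl)

end SubGaussian

/-! ### Predictable coordinates of the features -/

section Coordinates

variable {E H : Type*} [NormedAddCommGroup H] [InnerProductSpace ℝ H]

/-- The Gram–Schmidt orthogonalization of the features of a sequence of arms.  The features may be linearly
dependent; then some of the vectors are zero. -/
def gsVec (φ : E → H) (x : ℕ → E) (r : ℕ) : H :=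
  InnerProductSpace.gramSchmidt ℝ (fun s => φ (x s)) r

/-- Coordinate `r` of the feature of arm `x s` with respect to the normalization of `gsVec`; it is zero if
`gsVec φ x r` is. -/
def gsCoord (φ : E → H) (x : ℕ → E) (s r : ℕ) : ℝ :=
  ‖gsVec φ x r‖⁻¹ * inner ℝ (gsVec φ x r) (φ (x s))

theorem feature_eq_gsVec_add (φ : E → H) (x : ℕ → E) (r : ℕ) :
    φ (x r) = gsVec φ x r + ∑ i ∈ Finset.range r,
      (inner ℝ (gsVec φ x i) (φ (x r)) / ‖gsVec φ x i‖ ^ 2) • gsVec φ x i := by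
  have h := InnerProductSpace.gramSchmidt_def'' ℝ (fun s => φ (x s)) r
  rw [Nat.Iio_eq_range] at h
  exact h

theorem inner_gsVec (φ : E → H) (x : ℕ → E) (r : ℕ) (z : E) :
    inner ℝ (gsVec φ x r) (φ z) = kernel φ (x r) z - ∑ i ∈ Finset.range r,
      inner ℝ (gsVec φ x i) (φ (x r)) / ‖gsVec φ x i‖ ^ 2 * inner ℝ (gsVec φ x i) (φ z) := by
  have h := congrArg (fun v => inner ℝ v (φ z)) (feature_eq_gsVec_add φ x r)
  simp only [inner_add_left, sum_inner, real_inner_smul_left] at h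
  rw [kernel, h, add_sub_cancel_right]

theorem inner_gsVec_self (φ : E → H) (x : ℕ → E) (r : ℕ) :
    inner ℝ (gsVec φ x r) (φ (x r)) = ‖gsVec φ x r‖ ^ 2 := by
  rw [feature_eq_gsVec_add φ x r, inner_add_right, inner_sum, real_inner_self_eq_norm_sq,
    Finset.sum_eq_zero, add_zero]
  intro i hi
  rw [real_inner_smul_right, gsVec, gsVec,
    InnerProductSpace.gramSchmidt_orthogonal ℝ _ (Finset.mem_range.1 hi).ne', mul_zero]

theorem inner_gsVec_of_lt (φ : E → H) (x : ℕ → E) {s r : ℕ} (h : s < r) :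
    inner ℝ (gsVec φ x r) (φ (x s)) = 0 :=
  InnerProductSpace.gramSchmidt_inv_triangular ℝ (fun s => φ (x s)) h

theorem gsCoord_of_lt (φ : E → H) (x : ℕ → E) {s r : ℕ} (h : s < r) : gsCoord φ x s r = 0 := by
  rw [gsCoord, inner_gsVec_of_lt φ x h, mul_zero]

/-- The coordinates reproduce the kernel. -/
theorem sum_gsCoord_mul (φ : E → H) (x : ℕ → E) {n s : ℕ} (hs : s < n) (s' : ℕ) :
    ∑ r : Fin n, gsCoord φ x s r * gsCoord φ x s' r = kernel φ (x s) (x s') := by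
  have h1 : ∀ r, gsCoord φ x s r * gsCoord φ x s' r
      = inner ℝ (gsVec φ x r) (φ (x s)) / ‖gsVec φ x r‖ ^ 2
        * inner ℝ (gsVec φ x r) (φ (x s')) := by
    intro r
    rw [gsCoord, gsCoord]
    ring
  have h2 : inner ℝ (gsVec φ x s) (φ (x s)) / ‖gsVec φ x s‖ ^ 2
      * inner ℝ (gsVec φ x s) (φ (x s')) = inner ℝ (gsVec φ x s) (φ (x s')) := by
    rw [inner_gsVec_self]
    by_cases h : gsVec φ x s = 0
    · rw [h, inner_zero_left, mul_zero]
    · rw [div_self (pow_ne_zero 2 (norm_ne_zero_iff.2 h)), one_mul]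
  rw [Fin.sum_univ_eq_sum_range (fun r => gsCoord φ x s r * gsCoord φ x s' r) n,
    ← Finset.sum_subset (Finset.range_subset_range.2 (Nat.succ_le_of_lt hs))]
  · rw [Finset.sum_range_succ, h1 s, h2, inner_gsVec φ x s (x s')]
    simp only [h1]
    ring
  · intro r _ hr
    rw [gsCoord_of_lt φ x (by simpa using hr), zero_mul]

end Coordinates

/-! ### Measurability -/

section Measurability

variable {E H : Type*} [NormedAddCommGroup H] [InnerProductSpace ℝ H]

/-- The orthogonalized features are only used through their inner products with features, which are
measurable although no measurability of `φ` itself is assumed: they are rational functions of kernel values. -/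
theorem measurable_inner_gsVec [MeasurableSpace E] {Ω : Type*} {mΩ : MeasurableSpace Ω} {φ : E → H}
    (hk : Measurable fun p : E × E => kernel φ p.1 p.2) {x : ℕ → Ω → E} {r : ℕ} {Z : Ω → E}
    (hx : ∀ s ≤ r, Measurable (x s)) (hZ : Measurable Z) :
    Measurable fun ω => inner ℝ (gsVec φ (fun s => x s ω) r) (φ (Z ω)) := by
  induction r using Nat.strong_induction_on generalizing Z with
  | _ r ih =>
    have h1 : ∀ i < r, Measurable fun ω => ‖gsVec φ (fun s => x s ω) i‖ ^ 2 := by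
      intro i hi
      simp only [← inner_gsVec_self]
      exact ih i hi (fun s hs => hx s (hs.trans hi.le)) (hx i hi.le)
    have h2 : Measurable fun ω => kernel φ (x r ω) (Z ω) := hk.comp ((hx r le_rfl).prodMk hZ)
    simp only [inner_gsVec φ _ r]
    refine h2.sub (Finset.measurable_fun_sum _ fun i hi => ?_)
    have hi' := Finset.mem_range.1 hi
    have h3 : ∀ s ≤ i, Measurable (x s) := fun s hs => hx s (hs.trans hi'.le)
    exact ((ih i hi' h3 (hx r le_rfl)).div (h1 i hi')).mul (ih i hi' h3 hZ)

theorem measurable_gsCoord [MeasurableSpace E] {Ω : Type*} {mΩ : MeasurableSpace Ω} {φ : E → H}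
    (hk : Measurable fun p : E × E => kernel φ p.1 p.2) {x : ℕ → Ω → E} {s : ℕ}
    (hx : ∀ s' ≤ s, Measurable (x s')) (r : ℕ) :
    Measurable fun ω => gsCoord φ (fun s => x s ω) s r := by
  rcases lt_or_ge s r with h | h
  · simp only [gsCoord_of_lt φ _ h]
    exact measurable_const
  · have hx' : ∀ s' ≤ r, Measurable (x s') := fun s' hs' => hx s' (hs'.trans h)
    have h1 : ∀ ω, ‖gsVec φ (fun s => x s ω) r‖
        = Real.sqrt (inner ℝ (gsVec φ (fun s => x s ω) r) (φ (x r ω))) := fun ω => by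
      rw [inner_gsVec_self φ (fun s => x s ω) r, Real.sqrt_sq (norm_nonneg _)]
    simp only [gsCoord, h1]
    exact (measurable_inner_gsVec hk hx' (hx r h)).sqrt.inv.mul
      (measurable_inner_gsVec hk hx' (hx s le_rfl))

theorem measurable_info [MeasurableSpace E] {Ω : Type*} {mΩ : MeasurableSpace Ω} {φ : E → H}
    (hk : Measurable fun p : E × E => kernel φ p.1 p.2) {x : ℕ → Ω → E} {S : Finset ℕ}
    (hx : ∀ s ∈ S, Measurable (x s)) (lam : ℝ) :
    Measurable fun ω => info φ lam (fun s => x s ω) S := by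
  refine Measurable.log ?_
  simp only [dataDet, infoDet, Matrix.det_apply]
  refine Finset.measurable_fun_sum _ fun σ _ => ?_
  refine Measurable.const_smul (Finset.measurable_fun_prod _ fun i _ => ?_) _
  exact measurable_const.add (Measurable.const_mul
    (hk.comp ((hx _ (σ i).2).prodMk (hx _ i.2))) _)

theorem measurableSet_triggerAt [MeasurableSpace E] {Ω : Type*} {mΩ : MeasurableSpace Ω} {φ : E → H}
    (hk : Measurable fun p : E × E => kernel φ p.1 p.2) {x : ℕ → Ω → E} {τ t : ℕ} (hτ : τ ≤ t)
    (hx : ∀ s ≤ t, Measurable (x s)) (lam D : ℝ) (N : ℕ) :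
    MeasurableSet {ω | TriggerAt φ lam D N (fun s => x s ω) τ t} := by
  have h : ∀ S ⊆ Finset.range (t + 1), Measurable fun ω => info φ lam (fun s => x s ω) S :=
    fun S hS => measurable_info hk
      (fun s hs => hx s (Nat.lt_succ_iff.1 (Finset.mem_range.1 (hS hs)))) lam
  exact measurableSet_lt measurable_const (((h _ (clientData_subset_range (hτ.trans t.le_succ) _)).sub
    (h _ (Finset.range_subset_range.2 (hτ.trans t.le_succ)))).const_mul _)

theorem measurable_lastSync [MeasurableSpace E] {Ω : Type*} {mΩ : MeasurableSpace Ω} {φ : E → H}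
    (hk : Measurable fun p : E × E => kernel φ p.1 p.2) {lam : ℝ} (hlam : 0 < lam) (D : ℝ)
    (N d : ℕ) {x : ℕ → Ω → E} {t : ℕ} (hx : ∀ s < t, Measurable (x s)) :
    Measurable fun ω => lastSync φ lam D N d (fun s => x s ω) t := by
  classical
  induction t with
  | zero => exact measurable_const
  | succ t ih =>
    have ih' := ih fun s hs => hx s (hs.trans t.lt_succ_self)
    set τ := fun ω => lastSync φ lam D N d (fun s => x s ω) t with hτ
    have h1 : MeasurableSet {ω | TriggerAt φ lam D N (fun s => x s ω) (τ ω) t} := by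
      have h2 : {ω | TriggerAt φ lam D N (fun s => x s ω) (τ ω) t}
          = ⋃ k ∈ Finset.range (t + 1),
            (τ ⁻¹' {k} ∩ {ω | TriggerAt φ lam D N (fun s => x s ω) k t}) := by
        ext ω
        have h3 : τ ω ≤ t := lastSync_le φ lam D N d _ t
        simp [h3]
      rw [h2]
      refine Finset.measurableSet_biUnion _ fun k hk' => ?_
      exact (ih' (measurableSet_singleton k)).inter (measurableSet_triggerAt hk
        (Nat.lt_succ_iff.1 (Finset.mem_range.1 hk')) (fun s hs => hx s (Nat.lt_succ_iff.2 hs)) lam D N)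
    have h4 : (fun ω => lastSync φ lam D N d (fun s => x s ω) (t + 1))
        = fun ω => if TriggerAt φ lam D N (fun s => x s ω) (τ ω) t then t + 1 else τ ω := by
      ext ω
      split_ifs with h
      · exact lastSync_succ_of_trigger φ hlam D N d _ t h
      · exact lastSync_succ_of_not_trigger φ hlam D N d _ t h
    rw [h4]
    exact Measurable.ite h1 measurable_const ih'

/-- Evaluation of a family of measurable functions at a measurable bounded index. -/
theorem measurable_apply_index {α β : Type*} {mα : MeasurableSpace α} [MeasurableSpace β]
    {τ : α → ℕ} (hτ : Measurable τ) {t : ℕ} (hle : ∀ a, τ a ≤ t) {f : ℕ → α → β}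
    (hf : ∀ k ≤ t, Measurable (f k)) : Measurable fun a => f (τ a) a := by
  have h1 : Measurable fun p : ℕ × α => f (min p.1 t) p.2 :=
    measurable_from_prod_countable_right fun k => hf _ (min_le_right k t)
  have h2 := h1.comp (hτ.prodMk measurable_id)
  have h3 : (fun a => f (τ a) a) = (fun p : ℕ × α => f (min p.1 t) p.2) ∘ fun a => (τ a, id a) := by
    ext a
    simp [min_eq_left (hle a)]
  rw [h3]
  exact h2

theorem measurable_logLik {α : Type*} {mα : MeasurableSpace α} (R : ℝ) {u η : α → ℕ → ℝ}
    {S : Finset ℕ} (hu : ∀ s ∈ S, Measurable fun a => u a s)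
    (hη : ∀ s ∈ S, Measurable fun a => η a s) : Measurable fun a => logLik R (u a) (η a) S := by
  refine Finset.measurable_fun_sum _ fun s hs => ?_
  have h1 := hu s hs
  have h2 := hη s hs
  fun_prop

theorem measurable_potential {α : Type*} {mα : MeasurableSpace α} (N : ℕ) (R : ℝ)
    {u η : α → ℕ → ℝ} {τ : α → ℕ} {t : ℕ} (hτ : Measurable τ) (hle : ∀ a, τ a ≤ t)
    (hu : ∀ s < t, Measurable fun a => u a s) (hη : ∀ s < t, Measurable fun a => η a s) :
    Measurable fun a => potential N R (u a) (η a) (τ a) t := by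
  refine measurable_apply_index (f := fun k a => potential N R (u a) (η a) k t) hτ hle fun k hk => ?_
  have h : ∀ S ⊆ Finset.range t, Measurable fun a => logLik R (u a) (η a) S := fun S hS =>
    measurable_logLik R (fun s hs => hu s (Finset.mem_range.1 (hS hs)))
      fun s hs => hη s (Finset.mem_range.1 (hS hs))
  have h1 := h _ (Finset.range_subset_range.2 hk)
  have h2 := fun j => h _ (Finset.subset_union_right.trans
    (clientData_subset_range (N := N) hk j))
  have h3 := h (Finset.Ico k t) fun s hs => Finset.mem_range.2 (Finset.mem_Ico.1 hs).2
  unfold potential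
  fun_prop

theorem measurable_potentialFactor {α : Type*} {mα : MeasurableSpace α} (N : ℕ) (R : ℝ)
    {u η : α → ℕ → ℝ} {τ : α → ℕ} {t : ℕ} (hτ : Measurable τ) (hle : ∀ a, τ a ≤ t)
    (hu : ∀ s < t, Measurable fun a => u a s) (hη : ∀ s < t, Measurable fun a => η a s) :
    Measurable fun a => potentialFactor N R (u a) (η a) (τ a) t := by
  refine measurable_apply_index (f := fun k a => potentialFactor N R (u a) (η a) k t) hτ hle
    fun k hk => ?_
  have h : ∀ S ⊆ Finset.range t, Measurable fun a => logLik R (u a) (η a) S := fun S hS =>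
    measurable_logLik R (fun s hs => hu s (Finset.mem_range.1 (hS hs)))
      fun s hs => hη s (Finset.mem_range.1 (hS hs))
  have h1 := h _ (Finset.range_subset_range.2 hk)
  have h2 := h _ (Finset.subset_union_right.trans
    (clientData_subset_range (N := N) hk (t % N)))
  have h3 := h (Finset.Ico k t) fun s hs => Finset.mem_range.2 (Finset.mem_Ico.1 hs).2
  unfold potentialFactor
  fun_prop

end Measurability

/-! ### The mixture of the potentials -/

section MixPotential

variable {E H : Type*} [NormedAddCommGroup H] [InnerProductSpace ℝ H]

/-- The coefficients of the first `n` interactions in direction `ξ`. -/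
def dirCoef {n : ℕ} (φ : E → H) (lam R : ℝ) (x : ℕ → E) (ξ : Fin n → ℝ) : ℕ → ℝ :=
  coef lam R (fun s (r : Fin n) => gsCoord φ x s r) ξ

/-- The potential after `t` interactions in direction `ξ`. -/
def dirPotential {n : ℕ} (φ : E → H) (lam R D : ℝ) (N d : ℕ) (x : ℕ → E) (η : ℕ → ℝ) (t : ℕ)
    (ξ : Fin n → ℝ) : ℝ :=
  potential N R (dirCoef φ lam R x ξ) η (lastSync φ lam D N d x t) t

/-- The Gaussian mixture of the potentials after `t` interactions. -/
def mixPotential (n : ℕ) (φ : E → H) (lam R D : ℝ) (N d : ℕ) (x : ℕ → E) (η : ℕ → ℝ) (t : ℕ) :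
    ENNReal :=
  ∫⁻ ξ : Fin n → ℝ, ENNReal.ofReal (dirPotential φ lam R D N d x η t ξ * gaussWeight ξ)

theorem gaussWeight_nonneg {n : ℕ} (ξ : Fin n → ℝ) : 0 ≤ gaussWeight ξ := Real.exp_nonneg _

theorem mixPotential_zero (n : ℕ) (φ : E → H) (lam R D : ℝ) (N d : ℕ) (x : ℕ → E) (η : ℕ → ℝ) :
    mixPotential n φ lam R D N d x η 0 = ENNReal.ofReal N * gaussMass n := by
  have h : lastSync φ lam D N d x 0 = 0 := Nat.le_zero.1 (lastSync_le φ lam D N d x 0)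
  simp only [mixPotential, dirPotential, h, potential_zero, ENNReal.ofReal_mul N.cast_nonneg]
  rw [lintegral_const_mul' _ _ ENNReal.ofReal_ne_top, gaussMass]

/-- As long as the mixture of the potentials is at most `N / δ` times the Gaussian mass, the noise of the
data set of every client is bounded, because the potential dominates `√(m S)` for each data set `S`. -/
theorem noiseBounded_of_mixPotential_le (φ : E → H) {lam R δ : ℝ} (hlam : 0 < lam) (hR : 0 < R)
    (hδ : 0 < δ) {N : ℕ} (hN : 1 ≤ N) (D : ℝ) (d : ℕ) (x : ℕ → E) (η : ℕ → ℝ) {n t : ℕ}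
    (ht : t ≤ n)
    (h : mixPotential n φ lam R D N d x η t ≤ ENNReal.ofReal (N / δ) * gaussMass n)
    {j : ℕ} (hj : j < N) :
    NoiseBounded φ lam R δ N x η (clientData N (lastSync φ lam D N d x t) t j) := by
  set S := clientData N (lastSync φ lam D N d x t) t j with hS
  have hSn : ∀ s ∈ S, s < n := fun s hs => (Finset.mem_range.1
    (clientData_subset_range (lastSync_le φ lam D N d x t) j hs)).trans_le ht
  have h1 := lintegral_exp_half_logLik φ hlam hR x η S (fun s (r : Fin n) => gsCoord φ x s r)
    fun s hs s' _ => sum_gsCoord_mul φ x (hSn s hs) s'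
  have h2 : ENNReal.ofReal (Real.exp (noiseForm φ lam x η S / (4 * R ^ 2))
      * (Real.sqrt (dataDet φ lam x S))⁻¹) * gaussMass n
      ≤ ENNReal.ofReal (N / δ) * gaussMass n := by
    rw [← h1]
    refine le_trans (lintegral_mono fun ξ => ENNReal.ofReal_le_ofReal
      (mul_le_mul_of_nonneg_right ?_ (gaussWeight_nonneg ξ))) h
    exact exp_half_logLik_clientData_le R (dirCoef φ lam R x ξ) η _ t hj
  have hN0 : (0 : ℝ) < N := by exact_mod_cast hN
  have hc : 0 < (N : ℝ) / δ := div_pos hN0 hδ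
  have hdet := dataDet_pos φ hlam x S
  have h3 := (ENNReal.ofReal_le_ofReal_iff hc.le).1
    ((ENNReal.mul_le_mul_iff_left (gaussMass_ne_zero n) (gaussMass_ne_top n)).1 h2)
  have h4 := Real.log_le_log (by positivity) h3
  rw [Real.log_mul (Real.exp_ne_zero _) (by positivity), Real.log_exp, Real.log_inv,
    Real.log_sqrt hdet.le] at h4
  have h5 : noiseForm φ lam x η S / (4 * R ^ 2) ≤ Real.log (N / δ) + info φ lam x S / 2 := by
    rw [info]
    linarith
  rw [div_le_iff₀ (by positivity)] at h5
  rw [NoiseBounded]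
  linarith

/-- The potential after interaction `t` is what the interaction makes of it, or less if a synchronization
takes place. -/
theorem dirPotential_succ_le (φ : E → H) {lam : ℝ} (hlam : 0 < lam) (R D : ℝ) {N : ℕ} (hN : 1 ≤ N)
    (d : ℕ) (x : ℕ → E) (η : ℕ → ℝ) (t : ℕ) {n : ℕ} (ξ : Fin n → ℝ) :
    dirPotential φ lam R D N d x η (t + 1) ξ
      ≤ potentialRest N R (dirCoef φ lam R x ξ) η (lastSync φ lam D N d x t) t
        + potentialFactor N R (dirCoef φ lam R x ξ) η (lastSync φ lam D N d x t) t
          * Real.exp (dirCoef φ lam R x ξ t * η t - dirCoef φ lam R x ξ t ^ 2 * R ^ 2 / 2) := by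
  have hτ := lastSync_le φ lam D N d x t
  rw [← potential_succ hN R _ η hτ, dirPotential]
  by_cases h : TriggerAt φ lam D N x (lastSync φ lam D N d x t) t
  · rw [lastSync_succ_of_trigger φ hlam D N d x t h]
    exact potential_sync_le hN R _ η (hτ.trans t.le_succ)
  · rw [lastSync_succ_of_not_trigger φ hlam D N d x t h]

end MixPotential

section MixMeasurable

variable {E H : Type*} [NormedAddCommGroup H] [InnerProductSpace ℝ H]

theorem measurable_dirCoef [MeasurableSpace E] {Ω : Type*} {mΩ : MeasurableSpace Ω} {φ : E → H}
    (hk : Measurable fun p : E × E => kernel φ p.1 p.2) {x : ℕ → Ω → E} {s : ℕ}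
    (hx : ∀ s' ≤ s, Measurable (x s')) (lam R : ℝ) (n : ℕ) :
    Measurable fun p : Ω × (Fin n → ℝ) => dirCoef φ lam R (fun s => x s p.1) p.2 s := by
  refine Measurable.const_mul (Finset.measurable_fun_sum _ fun r _ => ?_) _
  exact ((measurable_gsCoord hk hx r).comp measurable_fst).mul
    ((measurable_pi_apply r).comp measurable_snd)

theorem measurable_dirCoef_apply [MeasurableSpace E] {Ω : Type*} {mΩ : MeasurableSpace Ω} {φ : E → H}
    (hk : Measurable fun p : E × E => kernel φ p.1 p.2) {x : ℕ → Ω → E} {s : ℕ}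
    (hx : ∀ s' ≤ s, Measurable (x s')) (lam R : ℝ) {n : ℕ} (ξ : Fin n → ℝ) :
    Measurable fun ω => dirCoef φ lam R (fun s => x s ω) ξ s :=
  (measurable_dirCoef hk hx lam R n).comp measurable_prodMk_right

theorem measurable_dirPotential [MeasurableSpace E] {Ω : Type*} {mΩ : MeasurableSpace Ω} {φ : E → H}
    (hk : Measurable fun p : E × E => kernel φ p.1 p.2) {lam : ℝ} (hlam : 0 < lam) (R D : ℝ)
    (N d : ℕ) {x : ℕ → Ω → E} {η : ℕ → Ω → ℝ} {t : ℕ}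
    (hx : ∀ s < t, Measurable (x s)) (hη : ∀ s < t, Measurable (η s)) (n : ℕ) :
    Measurable fun p : Ω × (Fin n → ℝ) =>
      dirPotential φ lam R D N d (fun s => x s p.1) (fun s => η s p.1) t p.2 :=
  measurable_potential N R ((measurable_lastSync hk hlam D N d hx).comp measurable_fst)
    (fun _ => lastSync_le φ lam D N d _ t)
    (fun _ hs => measurable_dirCoef hk (fun s' hs' => hx s' (hs'.trans_lt hs)) lam R n)
    fun s hs => (hη s hs).comp measurable_fst

theorem measurable_dirPotential_mul_gaussWeight [MeasurableSpace E] {Ω : Type*}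
    {mΩ : MeasurableSpace Ω} {φ : E → H}
    (hk : Measurable fun p : E × E => kernel φ p.1 p.2) {lam : ℝ} (hlam : 0 < lam) (R D : ℝ)
    (N d : ℕ) {x : ℕ → Ω → E} {η : ℕ → Ω → ℝ} {t : ℕ}
    (hx : ∀ s < t, Measurable (x s)) (hη : ∀ s < t, Measurable (η s)) (n : ℕ) :
    Measurable fun p : Ω × (Fin n → ℝ) => ENNReal.ofReal
      (dirPotential φ lam R D N d (fun s => x s p.1) (fun s => η s p.1) t p.2 * gaussWeight p.2) :=
  ((measurable_dirPotential hk hlam R D N d hx hη n).mul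
    ((measurable_gaussWeight n).comp measurable_snd)).ennreal_ofReal

theorem measurable_mixPotential [MeasurableSpace E] {Ω : Type*} {mΩ : MeasurableSpace Ω} {φ : E → H}
    (hk : Measurable fun p : E × E => kernel φ p.1 p.2) {lam : ℝ} (hlam : 0 < lam) (R D : ℝ)
    (N d : ℕ) {x : ℕ → Ω → E} {η : ℕ → Ω → ℝ} {t : ℕ}
    (hx : ∀ s < t, Measurable (x s)) (hη : ∀ s < t, Measurable (η s)) (n : ℕ) :
    Measurable fun ω =>
      mixPotential n φ lam R D N d (fun s => x s ω) (fun s => η s ω) t :=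
  (measurable_dirPotential_mul_gaussWeight hk hlam R D N d hx hη n).lintegral_prod_right'

end MixMeasurable

/-! ### Coverage of the confidence intervals -/

section History

variable {Ω E : Type*}

theorem history_mono [MeasurableSpace E] (x : ℕ → Ω → E) (η : ℕ → Ω → ℝ) :
    Monotone (history x η) := by
  have h1 : ∀ {s t : ℕ}, s < t → MeasurableSpace.comap (x s) inferInstance
      ⊔ MeasurableSpace.comap (η s) inferInstance ≤ history x η t := fun {s t} h =>
    (le_iSup (fun s : Fin t => MeasurableSpace.comap (x s) inferInstance
      ⊔ MeasurableSpace.comap (η s) inferInstance) ⟨s, h⟩).trans le_sup_left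
  intro t t' h
  refine sup_le (iSup_le fun s => h1 (s.2.trans_le h)) ?_
  rcases h.eq_or_lt with rfl | h
  · exact le_sup_right
  · exact le_sup_left.trans (h1 h)

theorem measurable_arm_history [MeasurableSpace E] (x : ℕ → Ω → E) (η : ℕ → Ω → ℝ) {s t : ℕ}
    (h : s ≤ t) : Measurable[history x η t] (x s) :=
  measurable_iff_comap_le.2 (le_sup_right.trans (history_mono x η h))

theorem measurable_noise_history [MeasurableSpace E] (x : ℕ → Ω → E) (η : ℕ → Ω → ℝ) {s t : ℕ}
    (h : s < t) : Measurable[history x η t] (η s) :=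
  measurable_iff_comap_le.2 (le_sup_right.trans
    ((le_iSup (fun s : Fin t => MeasurableSpace.comap (x s) inferInstance
      ⊔ MeasurableSpace.comap (η s) inferInstance) ⟨s, h⟩).trans le_sup_left))

theorem history_le [MeasurableSpace E] {m0 : MeasurableSpace Ω} {x : ℕ → Ω → E} {η : ℕ → Ω → ℝ}
    {t : ℕ} (hx : ∀ s ≤ t, Measurable (x s)) (hη : ∀ s < t, Measurable (η s)) :
    history x η t ≤ m0 :=
  sup_le (iSup_le fun s => sup_le (hx s s.2.le).comap_le (hη s s.2).comap_le)
    (hx t le_rfl).comap_le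

end History

section Coverage

variable {E H : Type*} [NormedAddCommGroup H] [InnerProductSpace ℝ H]

/-- In a fixed direction `ξ`, the potential is a supermartingale. -/
theorem setLIntegral_dirPotential_succ_le [MeasurableSpace E] {Ω : Type*} {m0 : MeasurableSpace Ω}
    {μ : Measure Ω} [IsProbabilityMeasure μ] {φ : E → H}
    (hk : Measurable fun p : E × E => kernel φ p.1 p.2) {lam : ℝ} (hlam : 0 < lam) (R D : ℝ)
    {N : ℕ} (hN : 1 ≤ N) (d : ℕ) {x : ℕ → Ω → E} {η : ℕ → Ω → ℝ} {t : ℕ}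
    (hx : ∀ s ≤ t, Measurable (x s)) (hη : ∀ s ≤ t, Measurable (η s))
    (hsub : CondSubGaussian μ (history x η t) (η t) R) {B : Set Ω}
    (hB : MeasurableSet[history x η t] B) {n : ℕ} (ξ : Fin n → ℝ) :
    ∫⁻ ω in B, ENNReal.ofReal (dirPotential φ lam R D N d (fun s => x s ω) (fun s => η s ω)
        (t + 1) ξ * gaussWeight ξ) ∂μ
      ≤ ∫⁻ ω in B, ENNReal.ofReal (dirPotential φ lam R D N d (fun s => x s ω) (fun s => η s ω)
        t ξ * gaussWeight ξ) ∂μ := by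
  have hm : history x η t ≤ m0 := history_le hx fun s hs => hη s hs.le
  have hxm : ∀ s ≤ t, Measurable[history x η t] (x s) := fun s hs =>
    measurable_arm_history x η hs
  have hηm : ∀ s < t, Measurable[history x η t] (η s) := fun s hs =>
    measurable_noise_history x η hs
  refine setLIntegral_le_of_le_add_mul_exp hm (hη t le_rfl) hsub hB (gaussWeight_nonneg ξ)
    (fun ω => potentialRest_nonneg N R (dirCoef φ lam R (fun s => x s ω) ξ) (fun s => η s ω)
      (lastSync φ lam D N d (fun s => x s ω) t) t)
    (fun ω => potentialFactor_nonneg hN R (dirCoef φ lam R (fun s => x s ω) ξ) (fun s => η s ω)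
      (lastSync φ lam D N d (fun s => x s ω) t) t) ?_ ?_
    (fun ω => dirPotential_succ_le φ hlam R D hN d _ _ t ξ)
    fun ω => (potential_eq_add hN R _ _ _ t).symm.le
  · exact measurable_potentialFactor (mα := history x η t) N R
      (measurable_lastSync (mΩ := history x η t) hk hlam D N d fun s hs => hxm s hs.le)
      (fun _ => lastSync_le φ lam D N d _ t)
      (fun s hs => measurable_dirCoef_apply (mΩ := history x η t) hk
        (fun s' hs' => hxm s' (hs'.trans hs.le)) lam R ξ) hηm
  · exact measurable_dirCoef_apply (mΩ := history x η t) hk hxm lam R ξ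

/-- The probability that some confidence interval fails when it is used is at most `δ`: Ville's
inequality for the mixture of the potentials. -/
theorem measure_exists_not_noiseBounded_le [MeasurableSpace E] {Ω : Type*} {m0 : MeasurableSpace Ω}
    {μ : Measure Ω} [IsProbabilityMeasure μ] {φ : E → H}
    (hk : Measurable fun p : E × E => kernel φ p.1 p.2) {lam R δ : ℝ} (hlam : 0 < lam)
    (hR : 0 < R) (hδ : 0 < δ) (D : ℝ) {N : ℕ} (hN : 1 ≤ N) (d n : ℕ) {x : ℕ → Ω → E}
    {η : ℕ → Ω → ℝ} (hx : ∀ t < n, Measurable (x t)) (hη : ∀ t < n, Measurable (η t))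
    (hsub : ∀ t < n, CondSubGaussian μ (history x η t) (η t) R) :
    μ {ω | ∃ t < n, ¬ NoiseBounded φ lam R δ N (fun s => x s ω) (fun s => η s ω)
      (clientData N (lastSync φ lam D N d (fun s => x s ω) t) t (t % N))} ≤ ENNReal.ofReal δ := by
  have hN0 : (0 : ℝ) < N := by exact_mod_cast hN
  set Ψ : ℕ → Ω → ENNReal := fun t ω =>
    mixPotential n φ lam R D N d (fun s => x s ω) (fun s => η s ω) t with hΨ
  set c : ENNReal := ENNReal.ofReal (N / δ) * gaussMass n with hc
  have hm : ∀ t < n, history x η t ≤ m0 := fun t ht =>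
    history_le (fun s hs => hx s (lt_of_le_of_lt hs ht)) fun s hs => hη s (hs.trans ht)
  have hstep : ∀ t < n, ∀ B, MeasurableSet[history x η t] B →
      ∫⁻ ω in B, Ψ (t + 1) ω ∂μ ≤ ∫⁻ ω in B, Ψ t ω ∂μ := by
    intro t ht B hB
    have hjoint : ∀ k ≤ t + 1, Measurable fun p : Ω × (Fin n → ℝ) => ENNReal.ofReal
        (dirPotential φ lam R D N d (fun s => x s p.1) (fun s => η s p.1) k p.2
          * gaussWeight p.2) := fun k hk' =>
      measurable_dirPotential_mul_gaussWeight hk hlam R D N d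
        (fun s hs => hx s (by omega)) (fun s hs => hη s (by omega)) n
    simp only [hΨ, mixPotential]
    refine (lintegral_lintegral_swap (hjoint (t + 1) le_rfl).aemeasurable).trans_le
      (le_trans (lintegral_mono fun ξ => ?_)
        (lintegral_lintegral_swap (hjoint t t.le_succ).aemeasurable).ge)
    exact setLIntegral_dirPotential_succ_le hk hlam R D hN d
      (fun s hs => hx s (lt_of_le_of_lt hs ht)) (fun s hs => hη s (lt_of_le_of_lt hs ht))
      (hsub t ht) hB ξ
  have hville := mul_measure_exists_lt_le (μ := μ) (history x η) n hm (history_mono x η) Ψ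
    (fun t _ => measurable_mixPotential (mΩ := history x η t) hk hlam R D N d
      (fun s hs => measurable_arm_history x η hs.le)
      (fun s hs => measurable_noise_history x η hs) n) hstep c
  have h0 : ∫⁻ ω, Ψ 0 ω ∂μ = c * ENNReal.ofReal δ := by
    simp only [hΨ, mixPotential_zero, lintegral_const, measure_univ, mul_one, hc]
    rw [mul_right_comm, ← ENNReal.ofReal_mul (by positivity), div_mul_cancel₀ _ hδ.ne']
  have hc0 : c ≠ 0 := mul_ne_zero (ENNReal.ofReal_pos.2 (by positivity)).ne' (gaussMass_ne_zero n)
  have hct : c ≠ ⊤ := ENNReal.mul_ne_top ENNReal.ofReal_ne_top (gaussMass_ne_top n)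
  rw [h0, ENNReal.mul_le_mul_iff_right hc0 hct] at hville
  -- a failure at time `t` means that the mixture exceeds its initial value by the factor `1 / δ`
  refine (measure_mono ?_).trans hville
  rintro ω ⟨t, ht, hω⟩
  refine ⟨t, ht, lt_of_not_ge fun hle => hω ?_⟩
  exact noiseBounded_of_mixPotential_le φ hlam hR hδ hN D d _ _ ht.le hle (Nat.mod_lt t hN)

end Coverage

end

end DisKernelUCB

theorem mainTheorem2 :
    ∃ c : ℝ, 0 < c ∧
    ∀ lam R L κ δ : ℝ, 0 < lam → 0 < R → 0 < L → 0 < κ → 0 < δ → δ < 1 →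
    ∃ C : ℝ, 0 < C ∧
    ∀ (d N T : ℕ), 1 ≤ d → 1 ≤ N → 1 ≤ T →
    ∀ (H : Type*) [NormedAddCommGroup H] [InnerProductSpace ℝ H] [CompleteSpace H]
      (φ : EuclideanSpace ℝ (Fin d) → H) (θ : H) (A : Set (EuclideanSpace ℝ (Fin d))),
    Measurable (fun p : EuclideanSpace ℝ (Fin d) × EuclideanSpace ℝ (Fin d) =>
      DisKernelUCB.kernel φ p.1 p.2) →
    (∀ z ∈ A, ‖φ z‖ ≤ L) →
    (∃ z ∈ A, κ ≤ ‖φ z‖) →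
    ∀ (Ω : Type*) [MeasurableSpace Ω] (μ : Measure Ω) [IsProbabilityMeasure μ]
      (cand : ℕ → Ω → Set (EuclideanSpace ℝ (Fin d)))
      (x : ℕ → Ω → EuclideanSpace ℝ (Fin d)) (η y : ℕ → Ω → ℝ) (γ D : ℝ)
      (st : Ω → ℕ → DisKernelUCB.State),
    γ = DisKernelUCB.maxInfoGain φ lam A (N * T) →
    D = T / (N * γ) →
    (∀ ω, st ω = DisKernelUCB.stateAt φ lam D N d (fun s => x s ω)) →
    (∀ t < N * T, Measurable (x t) ∧ Measurable (η t)) →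
    (∀ t < N * T, DisKernelUCB.CondSubGaussian μ (DisKernelUCB.history x η t) (η t) R) →
    (∀ t < N * T, ∀ ω, y t ω = inner ℝ θ (φ (x t ω)) + η t ω) →
    (∀ t < N * T, ∀ ω, cand t ω ⊆ A) →
    (∀ t < N * T, ∀ ω, x t ω ∈ cand t ω ∧
      IsMaxOn (DisKernelUCB.ucb φ θ lam R δ N (fun s => x s ω) (fun s => y s ω)
        ((st ω t).data (t % N))) (cand t ω) (x t ω)) →
    μ {ω | C * (Real.sqrt (N * T) * (‖θ‖ * Real.sqrt γ + γ))
        < DisKernelUCB.regret φ θ (fun t => cand t ω) (fun s => x s ω) (N * T)} ≤ ENNReal.ofReal δ ∧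
    (∀ ω, ((st ω (N * T)).syncs : ℝ) ≤ c * (Real.sqrt N * γ + N * γ ^ 2 / T)) ∧
    (Real.sqrt N * γ ≤ T → ∀ ω, ((st ω (N * T)).syncs : ℝ) ≤ c * (Real.sqrt N * γ)) ∧
    (∀ ω, ((st ω (N * T)).cost : ℝ) ≤ c * (T * N ^ 2 * d)) := by
  refine ⟨4, by norm_num, fun lam R L κ δ hlam hR hL hκ hδ hδ1 =>
    ⟨DisKernelUCB.regretConst lam R L κ δ, DisKernelUCB.regretConst_pos hlam hR hL κ δ, ?_⟩⟩
  intro d N T hd hN hT H _ _ _ φ θ A hk hA hA' Ω _ μ _ cand x η y γ D st hγ hD hst hm hsub hy hcand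
    hplay
  obtain ⟨z, hzA, hz⟩ := hA'
  have hN0 : (0 : ℝ) < N := by exact_mod_cast hN
  have hT0 : (0 : ℝ) < T := by exact_mod_cast hT
  have hγ1 : γ ≤ (1 / 2) * ((N * T : ℕ) * (L ^ 2 / lam)) :=
    hγ.trans_le (DisKernelUCB.maxInfoGain_le φ hlam hA (N * T))
  have hγ2 : (1 / 2) * Real.log (1 + (N * T : ℕ) * (κ ^ 2 / lam)) ≤ γ :=
    (DisKernelUCB.half_log_le_maxInfoGain φ hlam hκ hA hzA hz (N * T)).trans_eq hγ.symm
  have hγ0 : 0 < γ := by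
    refine lt_of_lt_of_le (mul_pos one_half_pos (Real.log_pos ?_)) hγ2
    have : (0 : ℝ) < (N * T : ℕ) := by exact_mod_cast Nat.mul_pos hN hT
    have : 0 < ((N * T : ℕ) : ℝ) * (κ ^ 2 / lam) := by positivity
    linarith
  have hxA : ∀ ω, ∀ t < N * T, x t ω ∈ A := fun ω t ht => hcand t ht ω (hplay t ht ω).1
  have hsyncs : ∀ ω, ((st ω (N * T)).syncs : ℝ) ≤ 2 * (Real.sqrt N * γ + N * γ ^ 2 / T) := by
    intro ω
    rw [hst ω, hD]
    exact DisKernelUCB.syncs_le φ hlam hN hT d _ hA (hxA ω) hγ hγ0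
  refine ⟨?_, fun ω => ?_, fun hT' ω => ?_, fun ω => ?_⟩
  · refine (measure_mono fun ω hω => ?_).trans
      (DisKernelUCB.measure_exists_not_noiseBounded_le hk hlam hR hδ D hN d (N * T)
        (fun t ht => (hm t ht).1) (fun t ht => (hm t ht).2) hsub)
    by_contra hcov
    have hcov' : ∀ t < N * T, DisKernelUCB.NoiseBounded φ lam R δ N (fun s => x s ω)
        (fun s => η s ω) (DisKernelUCB.clientData N
          (DisKernelUCB.lastSync φ lam D N d (fun s => x s ω) t) t (t % N)) := by
      intro t ht
      by_contra h
      exact hcov ⟨t, ht, h⟩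
    refine absurd (Set.mem_ofPred_eq ▸ hω) (not_lt.2 ?_)
    rw [hD] at hcov'
    refine DisKernelUCB.regret_le φ hlam hR hL hκ hδ hδ1 hN hT d hγ0 hγ1 hγ2 θ _
      (fun s => y s ω) (fun s => η s ω) _ ?_ (fun s hs => hA _ (hxA ω s hs))
      (fun s hs => hy s hs ω) (fun s hs => ?_) hcov'
    · rw [hγ]
      exact DisKernelUCB.info_le_two_mul_maxInfoGain φ hlam hA _ _ (hxA ω)
    · have h := hplay s hs ω
      rwa [hst ω, DisKernelUCB.stateAt_data, hD] at h
  · have h : 0 ≤ Real.sqrt N * γ + N * γ ^ 2 / T := by positivity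
    linarith [hsyncs ω]
  · have h : N * γ ^ 2 / T ≤ Real.sqrt N * γ := by
      rw [div_le_iff₀ hT0]
      calc N * γ ^ 2 = (Real.sqrt N * γ) * (Real.sqrt N * γ) := by
            rw [mul_mul_mul_comm, Real.mul_self_sqrt hN0.le, sq]
        _ ≤ (Real.sqrt N * γ) * T := mul_le_mul_of_nonneg_left hT' (by positivity)
    linarith [hsyncs ω]
  · have h1 := DisKernelUCB.cost_le φ hlam D N d (fun s => x s ω) (N * T)
    have h2 := DisKernelUCB.lastSync_le φ lam D N d (fun s => x s ω) (N * T)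
    have h3 : (st ω (N * T)).cost ≤ 4 * (T * N ^ 2 * d) := by
      rw [hst ω]
      calc _ ≤ N * (N * T) * (d + d) := h1.trans (Nat.mul_le_mul (Nat.mul_le_mul_left N h2)
            (Nat.add_le_add_left hd d))
        _ = 2 * (T * N ^ 2 * d) := by ring
        _ ≤ 4 * (T * N ^ 2 * d) := Nat.mul_le_mul_right _ (by norm_num)
    exact_mod_cast h3
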